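/- Let $d\ge 1$, let $\Omega\subset\mathbb R^d$ be open, bounded and connected with Lipschitz boundary, and let $\Sigma_v,\Sigma_p\subset\partial\Omega$ be relatively open and disjoint with $\partial\Omega=\overline{\Sigma_v\cup\Sigma_p}$. Let $2\le r<\infty$ and $s=\frac{r}{r-1}$. Let $\phi_1,\phi_2:[0,\infty)\to[0,\infty)$ be such that $\phi_1$ is continuous and nondecreasing on $[0,1]$, $\phi_2$ is continuous and nondecreasing on $[1,\infty)$, and for some $c,C>0$, $$c\,a^{\frac{r-2}{2}}\le\phi_2(a)\le C\bigl(1+a^{\frac{r-2}{2}}\bigr)\qquad\text{for all }a\ge 1 .$$ For $u\in L^r(\Omega)^d$ define the multivalued law $$\Lambda(u)=\bigl\{\phi_1(|u|^2)\,u\,\chi_{\{|u|<1\}}+\phi_2(|u|^2)\,u\,\chi_{\{|u|>1\}}+h\,\chi_{\{|u|=1\}} : h\in L^s(\Omega)^d\bigr\}\subset L^s(\Omega)^d .$$ Let $W_0^{1,s}(\Omega)$ be the set of $\xi\in W^{1,s}(\Omega)$ with $\int_\Omega\xi=0$ if $\mathcal H^{d-1}(\Sigma_p)=0$, and with zero trace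 on $\Sigma_p$ if $\mathcal H^{d-1}(\Sigma_p)>0$. Write $\langle g,\varphi\rangle=\int_\Omega g\cdot\varphi$ for $g\in L^s(\Omega)^d$, $\varphi\in L^r(\Omega)^d$, and $$V=\{\varphi\in L^r(\Omega)^d : \langle\nabla\psi,\varphi\rangle=0\ \text{ for all }\psi\in W_0^{1,s}(\Omega)\}.$$ Let $q\in L^r(\Omega)$, $u_0\in L^r(\Sigma_v)$ and $f_0\in L^s(\Omega)^d$. Given $\Lambda_u\in L^s(\Omega)^d$, consider for $(u,p)\in L^r(\Omega)^d\times W_0^{1,s}(\Omega)$ the equations $$\langle\Lambda_u,\varphi\rangle=-\langle\nabla p,\varphi\rangle+\langle f_0,\varphi\rangle,\qquad \langle\nabla\psi,u\rangle=-\int_\Omega q\psi+\int_{\Sigma_v}u_0\psi\qquad(\ast)$$ for all $\varphi\in L^r(\Omega)^d$ and $\psi\in W_0^{1,s}(\Omega)$. The mixed problem is to find $(u,p)\in L^r(\Omega)^d\times W_0^{1,s}(\Omega)$ such that $(\ast)$ holds for some $\Lambda_u\in\Lambda(u)$. Then there is a unique class in $L^r(\Omega)^d/V$ whose representatives $\hat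 u$ satisfy $$\langle\nabla\psi,\hat u\rangle=-\int_\Omega q\psi+\int_{\Sigma_v}u_0\psi\qquad\text{for all }\psi\in W_0^{1,s}(\Omega),$$ and for every such $\hat u$ the mixed problem is equivalent to the reduced problem of finding $v\in V$ such that there exists $\Lambda_v\in\Lambda(v+\hat u)$ with $$\langle\Lambda_v,\varphi\rangle=\langle f_0,\varphi\rangle\qquad\text{for all }\varphi\in V,$$ in the following sense: 1. if $(u,p)$ solves the mixed problem, then $v=u-\hat u$ solves the reduced problem; 2. if $v$ solves the reduced problem, then there is $p\in W_0^{1,s}(\Omega)$ such that $(v+\hat u,p)$ solves the mixed problem; 3. for every $v\in V$ and every $\Lambda_v\in\Lambda(v+\hat u)$ with $\langle\Lambda_v,\varphi\rangle=\langle f_0,\varphi\rangle$ for all $\varphi\in V$, there is exactly one $p\in W_0^{1,s}(\Omega)$ such that $(\ast)$ holds for $u=v+\hat u$ with $\Lambda_u=\Lambda_v$. -/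

import Mathlib

open MeasureTheory Filter Topology Set
open scoped ENNReal NNReal ContDiff

noncomputable section

namespace Fracture

/-- Euclidean space `ℝ^d`. -/
abbrev E (d : ℕ) := EuclideanSpace ℝ (Fin d)

/-- `Ω` has a Lipschitz boundary: near every boundary point, in suitable orthonormal coordinates
(with last coordinate axis spanned by the unit vector `e`), the set `Ω` is the strict epigraph of a
Lipschitz function of the remaining coordinates. -/
def HasLipschitzBoundary {d : ℕ} (Ω : Set (E d)) : Prop :=
  ∀ x ∈ frontier Ω, ∃ (e : E d) (K : ℝ≥0) (γ : (ℝ ∙ e)ᗮ → ℝ), ‖e‖ = 1 ∧ LipschitzWith K γ ∧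
    ∀ᶠ y in 𝓝 x, (y ∈ Ω ↔ γ ((ℝ ∙ e)ᗮ.orthogonalProjectionOnto y) < inner ℝ e y)

/-- `S` is a relatively open part of the boundary of `Ω`. -/
def IsRelOpenInBoundary {d : ℕ} (Ω S : Set (E d)) : Prop :=
  ∃ U : Set (E d), IsOpen U ∧ S = U ∩ frontier Ω

/-- Lebesgue measure on `Ω`. -/
abbrev vol {d : ℕ} (Ω : Set (E d)) : Measure (E d) := (volume : Measure (E d)).restrict Ω

/-- Surface measure of `∂Ω`: the `(d-1)`-dimensional Hausdorff measure, normalized to agree with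
Lebesgue measure on `(d-1)`-dimensional subspaces, restricted to `∂Ω`. -/
abbrev surf {d : ℕ} (Ω : Set (E d)) : Measure (E d) :=
  (Measure.euclideanHausdorffMeasure (d - 1) : Measure (E d)).restrict (frontier Ω)

/-- `G` is the weak gradient of `ψ` on `Ω`. -/
def IsWeakGradient {d : ℕ} (Ω : Set (E d)) (ψ : E d → ℝ) (G : E d → E d) : Prop :=
  ∀ η : E d → ℝ, ContDiff ℝ ∞ η → HasCompactSupport η → tsupport η ⊆ Ω →
    ∫ x in Ω, ψ x • gradient η x = - ∫ x in Ω, η x • G x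

section Spaces

variable {d : ℕ} (Ω : Set (E d)) (s : ℝ≥0∞)

/-- The Sobolev space `W^{1,s}(Ω)`. An element is a function of `L^s(Ω)` that has a weak gradient in
`L^s(Ω)`, recorded together with this (unique) weak gradient. -/
def sobolev [Fact (1 ≤ s)] : Submodule ℝ (Lp ℝ s (vol Ω) × Lp (E d) s (vol Ω)) where
  carrier := {ξ | IsWeakGradient Ω ξ.1 ξ.2}
  zero_mem' := by
    intro η _ _ _
    have h1 : ∫ x in Ω, ((0 : Lp ℝ s (vol Ω)) : E d → ℝ) x • gradient η x = 0 := by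
      refine integral_eq_zero_of_ae ?_
      filter_upwards [Lp.coeFn_zero ℝ s (vol Ω)] with x hx
      rw [hx]
      simp
    have h2 : ∫ x in Ω, η x • ((0 : Lp (E d) s (vol Ω)) : E d → E d) x = 0 := by
      refine integral_eq_zero_of_ae ?_
      filter_upwards [Lp.coeFn_zero (E d) s (vol Ω)] with x hx
      rw [hx]
      simp
    exact h1.trans (by rw [Prod.snd_zero, h2, neg_zero])
  add_mem' := by
    rintro ⟨a, A⟩ ⟨b, B⟩ ha hb η h1 h2 h3
    have hg : Continuous (gradient η) :=
      (InnerProductSpace.toDual ℝ (E d)).symm.continuous.comp (h1.continuous_fderiv (by simp))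
    have hgs : HasCompactSupport (gradient η) :=
      (h2.fderiv ℝ).comp_left (g := (InnerProductSpace.toDual ℝ (E d)).symm) (by simp)
    have l1 : ∀ c : Lp ℝ s (vol Ω), Integrable (fun x => c x • gradient η x) (vol Ω) := fun c =>
      ((Lp.memLp c).locallyIntegrable Fact.out).integrable_smul_right_of_hasCompactSupport hg hgs
    have l2 : ∀ c : Lp (E d) s (vol Ω), Integrable (fun x => η x • c x) (vol Ω) := fun c =>
      ((Lp.memLp c).locallyIntegrable Fact.out).integrable_smul_left_of_hasCompactSupport
        h1.continuous h2
    have e1 : ∫ x in Ω, (a + b : Lp ℝ s (vol Ω)) x • gradient η x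
        = (∫ x in Ω, a x • gradient η x) + ∫ x in Ω, b x • gradient η x := by
      rw [← integral_add (l1 a) (l1 b)]
      refine integral_congr_ae ?_
      filter_upwards [Lp.coeFn_add a b] with x hx
      rw [hx, Pi.add_apply, add_smul]
    have e2 : ∫ x in Ω, η x • (A + B : Lp (E d) s (vol Ω)) x
        = (∫ x in Ω, η x • A x) + ∫ x in Ω, η x • B x := by
      rw [← integral_add (l2 A) (l2 B)]
      refine integral_congr_ae ?_
      filter_upwards [Lp.coeFn_add A B] with x hx
      rw [hx, Pi.add_apply, smul_add]
    have ea := ha η h1 h2 h3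
    have eb := hb η h1 h2 h3
    simp only [Prod.mk_add_mk] at ea eb ⊢
    rw [e1, e2, ea, eb, neg_add]
  smul_mem' := by
    rintro c ⟨a, A⟩ ha η h1 h2 h3
    have e1 : ∫ x in Ω, (c • a : Lp ℝ s (vol Ω)) x • gradient η x
        = c • ∫ x in Ω, a x • gradient η x := by
      rw [← integral_smul]
      refine integral_congr_ae ?_
      filter_upwards [Lp.coeFn_smul c a] with x hx
      simp [hx, mul_smul]
    have e2 : ∫ x in Ω, η x • (c • A : Lp (E d) s (vol Ω)) x
        = c • ∫ x in Ω, η x • A x := by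
      rw [← integral_smul]
      refine integral_congr_ae ?_
      filter_upwards [Lp.coeFn_smul c A] with x hx
      simp [hx, smul_comm c]
    have ea := ha η h1 h2 h3
    simp only [Prod.smul_mk] at ea ⊢
    rw [e1, e2, ea, smul_neg]

variable {Ω s}

/-- The function underlying an element of `W^{1,s}(Ω)`. -/
def fn [Fact (1 ≤ s)] (ξ : sobolev Ω s) : Lp ℝ s (vol Ω) := ξ.1.1

/-- The weak gradient of an element of `W^{1,s}(Ω)`. -/
def grad [Fact (1 ≤ s)] (ξ : sobolev Ω s) : Lp (E d) s (vol Ω) := ξ.1.2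

/-- `g ∈ L^s(∂Ω)` is the boundary trace of `ξ ∈ W^{1,s}(Ω)`: some sequence of functions smooth up to
the boundary converges to `ξ` in `W^{1,s}(Ω)` while its boundary values converge to `g` in
`L^s(∂Ω)`. -/
def IsTrace [Fact (1 ≤ s)] (ξ : sobolev Ω s) (g : Lp ℝ s (surf Ω)) : Prop :=
  ∃ η : ℕ → E d → ℝ, (∀ n, ContDiff ℝ ∞ (η n)) ∧
    Tendsto (fun n => eLpNorm (fun x => η n x - fn ξ x) s (vol Ω)) atTop (𝓝 0) ∧
    Tendsto (fun n => eLpNorm (fun x => gradient (η n) x - grad ξ x) s (vol Ω)) atTop (𝓝 0) ∧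
    Tendsto (fun n => eLpNorm (fun x => η n x - g x) s (surf Ω)) atTop (𝓝 0)

open Classical in
/-- The trace operator `W^{1,s}(Ω) → L^s(∂Ω)`. On a bounded Lipschitz domain, with `1 ≤ s < ∞`, every
`ξ` has exactly one trace; the value `0` in the other branch is a mere convention. -/
def trace [Fact (1 ≤ s)] (ξ : sobolev Ω s) : Lp ℝ s (surf Ω) :=
  if h : ∃ g, IsTrace ξ g then h.choose else 0

variable (Ω s)

/-- The space `W_0^{1,s}(Ω)`: zero mean on `Ω` if the boundary part `Sp` is negligible, zero trace on
`Sp` otherwise. -/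
def sobolevZero [Fact (1 ≤ s)] (Sp : Set (E d)) : Set (sobolev Ω s) :=
  {ξ | (surf Ω Sp = 0 → ∫ x in Ω, fn ξ x = 0) ∧
    (0 < surf Ω Sp → ∀ᵐ x ∂((surf Ω).restrict Sp), trace ξ x = 0)}

variable {Ω s}
variable {r : ℝ≥0∞} [Fact (1 ≤ r)] [Fact (1 ≤ s)] [ENNReal.HolderConjugate s r]

/-- The duality pairing `⟨g, φ⟩ = ∫_Ω g · φ` on `L^s(Ω)^d × L^r(Ω)^d`. -/
def pairing : Lp (E d) s (vol Ω) →L[ℝ] Lp (E d) r (vol Ω) →L[ℝ] ℝ :=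
  (innerSL ℝ).lpPairing (vol Ω) s r

theorem pairing_eq_integral (g : Lp (E d) s (vol Ω)) (φ : Lp (E d) r (vol Ω)) :
    pairing g φ = ∫ x in Ω, inner ℝ (g x) (φ x) := by
  rw [pairing, ContinuousLinearMap.lpPairing_eq_integral]
  rfl

/-- The space `V` of fields in `L^r(Ω)^d` that annihilate all gradients of `W_0^{1,s}(Ω)`. -/
def V (Ω : Set (E d)) (r s : ℝ≥0∞) [Fact (1 ≤ r)] [Fact (1 ≤ s)] [ENNReal.HolderConjugate s r]
    (Sp : Set (E d)) : Submodule ℝ (Lp (E d) r (vol Ω)) where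
  carrier := {φ | ∀ ψ ∈ sobolevZero Ω s Sp, pairing (grad ψ) φ = 0}
  zero_mem' := by intro ψ _; simp
  add_mem' := by
    intro a b ha hb ψ hψ
    rw [map_add, ha ψ hψ, hb ψ hψ, add_zero]
  smul_mem' := by
    intro c a ha ψ hψ
    rw [map_smul, ha ψ hψ, smul_zero]

end Spaces

section Law

variable {d : ℕ}

/-- Low-speed region. -/
def lowSpeed (Ω : Set (E d)) (u : E d → E d) : Set (E d) := {x ∈ Ω | ‖u x‖ < 1}

/-- High-speed region. -/
def highSpeed (Ω : Set (E d)) (u : E d → E d) : Set (E d) := {x ∈ Ω | 1 < ‖u x‖}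

/-- Interface. -/
def interface (Ω : Set (E d)) (u : E d → E d) : Set (E d) := {x ∈ Ω | ‖u x‖ = 1}

/-- The field `φ(‖u‖²) u χ_A`. -/
def regionLaw (φ : ℝ≥0 → ℝ≥0) (u : E d → E d) (A : Set (E d)) : E d → E d :=
  A.indicator (fun x => φ (‖u x‖₊ ^ 2) • u x)

/-- The multivalued law
`Λ(u) = { φ₁(‖u‖²) u χ_{‖u‖<1} + φ₂(‖u‖²) u χ_{‖u‖>1} + h χ_{‖u‖=1} : h ∈ L^s(Ω)^d } ⊆ L^s(Ω)^d`. -/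
def law {Ω : Set (E d)} {r : ℝ≥0∞} (s : ℝ≥0∞) (φ₁ φ₂ : ℝ≥0 → ℝ≥0) (u : Lp (E d) r (vol Ω)) :
    Set (Lp (E d) s (vol Ω)) :=
  {g | ∃ h : Lp (E d) s (vol Ω),
    g =ᵐ[vol Ω] regionLaw φ₁ u (lowSpeed Ω u) + regionLaw φ₂ u (highSpeed Ω u)
      + (interface Ω u).indicator h}

/-- Assumptions on the two laws `φ₁, φ₂ : [0,∞) → [0,∞)` with growth exponent `r`. -/
structure IsAdmissible (r : ℝ≥0∞) (φ₁ φ₂ : ℝ≥0 → ℝ≥0) : Prop where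
  continuousOn_one : ContinuousOn φ₁ (Icc 0 1)
  monotoneOn_one : MonotoneOn φ₁ (Icc 0 1)
  continuousOn_two : ContinuousOn φ₂ (Ici 1)
  monotoneOn_two : MonotoneOn φ₂ (Ici 1)
  growth : ∃ c C : ℝ, 0 < c ∧ 0 < C ∧ ∀ a : ℝ≥0, 1 ≤ a →
    c * (a : ℝ) ^ ((r.toReal - 2) / 2) ≤ φ₂ a ∧
      (φ₂ a : ℝ) ≤ C * (1 + (a : ℝ) ^ ((r.toReal - 2) / 2))

end Law

section Problems

variable {d : ℕ} {Ω : Set (E d)} {r s : ℝ≥0∞} [Fact (1 ≤ r)] [Fact (1 ≤ s)]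
  [ENNReal.HolderConjugate s r]

/-- The data functional `ψ ↦ - ∫_Ω q ψ + ∫_{Sv} u₀ ψ`. -/
def dataFunctional (Sv : Set (E d)) (q : Lp ℝ r (vol Ω)) (u₀ : Lp ℝ r ((surf Ω).restrict Sv))
    (ψ : sobolev Ω s) : ℝ :=
  - (∫ x in Ω, q x * fn ψ x) + ∫ x, u₀ x * trace ψ x ∂((surf Ω).restrict Sv)

/-- The mass-conservation equation `⟨∇ψ, u⟩ = - ∫_Ω q ψ + ∫_{Sv} u₀ ψ` for all `ψ ∈ W_0^{1,s}(Ω)`. -/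
def IsLift (s : ℝ≥0∞) [Fact (1 ≤ s)] [ENNReal.HolderConjugate s r]
    (Sv Sp : Set (E d)) (q : Lp ℝ r (vol Ω)) (u₀ : Lp ℝ r ((surf Ω).restrict Sv))
    (u : Lp (E d) r (vol Ω)) : Prop :=
  ∀ ψ ∈ sobolevZero Ω s Sp, pairing (grad ψ) u = dataFunctional Sv q u₀ ψ

/-- `(u, p)` satisfies the two equations of the mixed weak formulation with the selection `Λu`. -/
def SolvesMixedWith (Sv Sp : Set (E d)) (q : Lp ℝ r (vol Ω))
    (u₀ : Lp ℝ r ((surf Ω).restrict Sv)) (f₀ : Lp (E d) s (vol Ω))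
    (Λu : Lp (E d) s (vol Ω)) (u : Lp (E d) r (vol Ω)) (p : sobolev Ω s) : Prop :=
  ∀ φ : Lp (E d) r (vol Ω), ∀ ψ ∈ sobolevZero Ω s Sp,
    pairing Λu φ = - pairing (grad p) φ + pairing f₀ φ ∧
      pairing (grad ψ) u = dataFunctional Sv q u₀ ψ

/-- `(u, p) ∈ L^r(Ω)^d × W_0^{1,s}(Ω)` solves the mixed weak formulation. -/
def SolvesMixed (Sv Sp : Set (E d)) (φ₁ φ₂ : ℝ≥0 → ℝ≥0) (q : Lp ℝ r (vol Ω))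
    (u₀ : Lp ℝ r ((surf Ω).restrict Sv)) (f₀ : Lp (E d) s (vol Ω))
    (u : Lp (E d) r (vol Ω)) (p : sobolev Ω s) : Prop :=
  p ∈ sobolevZero Ω s Sp ∧ ∃ Λu ∈ law s φ₁ φ₂ u, SolvesMixedWith Sv Sp q u₀ f₀ Λu u p

/-- `v` solves the reduced problem on `V`, for the lift `uhat`. -/
def SolvesReduced (Sp : Set (E d)) (φ₁ φ₂ : ℝ≥0 → ℝ≥0) (f₀ : Lp (E d) s (vol Ω))
    (uhat v : Lp (E d) r (vol Ω)) : Prop :=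
  v ∈ V Ω r s Sp ∧ ∃ Λv ∈ law s φ₁ φ₂ (v + uhat), ∀ φ ∈ V Ω r s Sp, pairing Λv φ = pairing f₀ φ

end Problems

end Fracture

end

/-
A field in `L^s` is a gradient of an element of `W_0^{1,s}` exactly when it annihilates `V`, and the
gradient is injective on `W_0^{1,s}`; both rest on a Poincaré inequality.

Record `ψ ∈ W_0^{1,s}` by the triple `(ψ, ∇ψ, trace ψ)`. Integration along segments controls a
smooth function near one point of `Ω` by its values near any other and by its gradient;
connectedness and compactness make this global, and sliding along the axis of a boundary chart gives
the trace inequality. The trace inequality shows that the normalization (zero mean or zero trace)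
is a closed condition that excludes constants, whence `‖(ψ, ∇ψ, trace ψ)‖ ≤ K ‖∇ψ‖` on `W_0^{1,s}`.
Consequently the gradients of `W_0^{1,s}` form a closed subspace of `L^s`, and every continuous
functional of the triple is one of `∇ψ`.

As `1 < s ≤ 2`, the Riesz theorem in `L^2 ⊆ L^s` shows that `L^r` is the dual of `L^s`. With the
Hahn-Banach theorem, extending `∇ψ ↦ -∫ q ψ + ∫ u₀ ψ` to `L^s` produces a lift, unique modulo `V`,
and separating a field from the closed subspace of gradients produces the pressure.
-/

namespace Fracture

section Energy

/-- The `p`-energy `∫ ‖f‖ᵖ dμ`, i.e. the `p`-th power of the `Lᵖ` norm. Working with the power keeps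
the estimates below additive in the measure. -/
noncomputable def energy {α G : Type*} [MeasurableSpace α] [ENorm G] (p : ℝ) (μ : Measure α)
    (f : α → G) : ℝ≥0∞ :=
  ∫⁻ x, ‖f x‖ₑ ^ p ∂μ

theorem energy_mono_measure {α G : Type*} [MeasurableSpace α] [ENorm G] {p : ℝ}
    {μ ν : Measure α} (h : μ ≤ ν) (f : α → G) : energy p μ f ≤ energy p ν f :=
  lintegral_mono' h le_rfl

theorem lintegral_rpow_le_of_isProbabilityMeasure {α : Type*} [MeasurableSpace α] {μ : Measure α}
    [IsProbabilityMeasure μ] {p : ℝ} (hp : 1 ≤ p) {f : α → ℝ≥0∞} (hf : AEMeasurable f μ) :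
    (∫⁻ x, f x ∂μ) ^ p ≤ ∫⁻ x, f x ^ p ∂μ := by
  have h := eLpNorm'_le_eLpNorm'_of_exponent_le one_pos hp μ hf.aestronglyMeasurable
  simp only [eLpNorm', enorm_eq_self, ENNReal.rpow_one, div_one, one_div] at h
  exact (ENNReal.le_rpow_inv_iff (one_pos.trans_le hp)).1 h

theorem enorm_rpow_le_two_rpow_mul_add {G : Type*} [SeminormedAddCommGroup G] {p : ℝ} (hp : 1 ≤ p)
    (a b : G) : ‖a‖ₑ ^ p ≤ 2 ^ (p - 1) * (‖b‖ₑ ^ p + ‖b - a‖ₑ ^ p) := by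
  refine le_trans ?_ (ENNReal.rpow_add_le_mul_rpow_add_rpow _ _ hp)
  gcongr
  simpa using enorm_sub_le (a := b) (b := b - a)

end Energy

section Segment

variable {F G : Type*} [NormedAddCommGroup F] [NormedSpace ℝ F] [NormedAddCommGroup G]
  [NormedSpace ℝ G] {p : ℝ} {η : F → G}

theorem measurable_enorm_fderiv_rpow [MeasurableSpace F] [BorelSpace F] (hη : ContDiff ℝ 1 η)
    (p : ℝ) : Measurable fun x => ‖fderiv ℝ η x‖ₑ ^ p :=
  ((hη.continuous_fderiv one_ne_zero).enorm.measurable).pow_const p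

theorem enorm_sub_rpow_le_lintegral_segment (hp : 1 ≤ p) (hη : ContDiff ℝ 1 η) (y v : F) {t : ℝ}
    (ht : t ∈ Icc (0 : ℝ) 1) :
    ‖η (y + t • v) - η y‖ₑ ^ p ≤
      ‖v‖ₑ ^ p * ∫⁻ θ in Icc (0 : ℝ) 1, ‖fderiv ℝ η (y + θ • v)‖ₑ ^ p := by
  have hderiv (θ : ℝ) :
      HasDerivAt (fun θ : ℝ => η (y + θ • v)) (fderiv ℝ η (y + θ • v) v) θ := by
    have hline : HasDerivAt (fun θ : ℝ => y + θ • v) v θ := by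
      simpa using ((hasDerivAt_id θ).smul_const v).const_add y
    exact (hη.differentiable one_ne_zero _).hasFDerivAt.comp_hasDerivAt θ hline
  have hincr : ‖η (y + t • v) - η y‖ₑ ≤
      ∫⁻ θ in Icc (0 : ℝ) 1, ‖v‖ₑ * ‖fderiv ℝ η (y + θ • v)‖ₑ := by
    have hC : ContDiff ℝ 1 (fun θ : ℝ => η (y + θ • v)) := by fun_prop
    have h := enorm_sub_le_lintegral_deriv_of_contDiffOn_Icc hC.contDiffOn ht.1
    simp only [zero_smul, add_zero] at h
    refine h.trans ((lintegral_mono_set (Icc_subset_Icc_right ht.2)).trans ?_)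
    refine lintegral_mono fun θ => ?_
    rw [(hderiv θ).deriv, mul_comm]
    exact ContinuousLinearMap.le_opENorm _ _
  have : IsProbabilityMeasure (volume.restrict (Icc (0 : ℝ) 1)) := ⟨by simp⟩
  have hmeas : Measurable fun θ : ℝ => ‖fderiv ℝ η (y + θ • v)‖ₑ :=
    ((hη.continuous_fderiv one_ne_zero).comp (by fun_prop)).enorm.measurable
  calc ‖η (y + t • v) - η y‖ₑ ^ p
      ≤ (∫⁻ θ in Icc (0 : ℝ) 1, ‖v‖ₑ * ‖fderiv ℝ η (y + θ • v)‖ₑ) ^ p := by gcongr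
    _ ≤ ∫⁻ θ in Icc (0 : ℝ) 1, (‖v‖ₑ * ‖fderiv ℝ η (y + θ • v)‖ₑ) ^ p :=
        lintegral_rpow_le_of_isProbabilityMeasure hp (hmeas.const_mul _).aemeasurable
    _ = _ := by
        rw [← lintegral_const_mul _ (hmeas.pow_const p)]
        exact lintegral_congr fun θ => ENNReal.mul_rpow_of_nonneg _ _ (by linarith)

theorem enorm_rpow_le_lintegral_segment (hp : 1 ≤ p) (hη : ContDiff ℝ 1 η) (y v : F) :
    ‖η y‖ₑ ^ p ≤ 2 ^ (p - 1) * ∫⁻ θ in Icc (0 : ℝ) 1,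
      (‖η (y + θ • v)‖ₑ ^ p + ‖v‖ₑ ^ p * ‖fderiv ℝ η (y + θ • v)‖ₑ ^ p) := by
  have h2 : (2 : ℝ≥0∞) ^ (p - 1) ≠ ⊤ := ENNReal.rpow_ne_top_of_nonneg (by linarith) (by simp)
  have hv : ‖v‖ₑ ^ p ≠ ⊤ := ENNReal.rpow_ne_top_of_nonneg (by linarith) (by simp)
  have hmeas : Measurable fun θ : ℝ => ‖η (y + θ • v)‖ₑ ^ p :=
    (hη.continuous.comp (by fun_prop)).enorm.measurable.pow_const p
  rw [lintegral_add_left hmeas, lintegral_const_mul' _ _ hv]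
  set I := ‖v‖ₑ ^ p * ∫⁻ θ in Icc (0 : ℝ) 1, ‖fderiv ℝ η (y + θ • v)‖ₑ ^ p
  calc ‖η y‖ₑ ^ p = ∫⁻ _ in Icc (0 : ℝ) 1, ‖η y‖ₑ ^ p := by simp
    _ ≤ ∫⁻ θ in Icc (0 : ℝ) 1, 2 ^ (p - 1) * (‖η (y + θ • v)‖ₑ ^ p + I) := by
        refine setLIntegral_mono' measurableSet_Icc fun θ hθ => ?_
        refine (enorm_rpow_le_two_rpow_mul_add hp (η y) (η (y + θ • v))).trans ?_
        gcongr
        exact enorm_sub_rpow_le_lintegral_segment hp hη y v hθ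
    _ = _ := by
        rw [lintegral_const_mul' _ _ h2, lintegral_add_left hmeas]
        simp

variable [FiniteDimensional ℝ F] [MeasurableSpace F] [BorelSpace F] (μ : Measure F)
  [μ.IsAddHaarMeasure]

theorem energy_translate_sub_le (hp : 1 ≤ p) (hη : ContDiff ℝ 1 η) {A O : Set F} (v : F)
    (hA : MeasurableSet A) (hO : MeasurableSet O)
    (h : ∀ y ∈ A, ∀ θ ∈ Icc (0 : ℝ) 1, y + θ • v ∈ O) :
    energy p (μ.restrict A) (fun y => η (y + v) - η y) ≤
      ‖v‖ₑ ^ p * energy p (μ.restrict O) (fderiv ℝ η) := by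
  set g : F → ℝ≥0∞ := O.indicator fun x => ‖fderiv ℝ η x‖ₑ ^ p with hg
  have hgm : Measurable g := (measurable_enorm_fderiv_rpow hη p).indicator hO
  have hseg : Measurable fun z : F × ℝ => g (z.1 + z.2 • v) := hgm.comp (by fun_prop)
  calc energy p (μ.restrict A) (fun y => η (y + v) - η y)
      ≤ ∫⁻ y in A, ‖v‖ₑ ^ p * (∫⁻ θ in Icc (0 : ℝ) 1, g (y + θ • v)) ∂μ := by
        refine setLIntegral_mono' hA fun y hy => ?_
        have hincr := enorm_sub_rpow_le_lintegral_segment hp hη y v (t := 1) (by simp)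
        rw [one_smul] at hincr
        refine hincr.trans (mul_le_mul_right (setLIntegral_mono' measurableSet_Icc
          fun θ hθ => ?_) _)
        rw [hg, indicator_of_mem (h y hy θ hθ)]
    _ = ‖v‖ₑ ^ p * ∫⁻ θ in Icc (0 : ℝ) 1, (∫⁻ y in A, g (y + θ • v) ∂μ) := by
        rw [lintegral_const_mul _ hseg.lintegral_prod_right',
          lintegral_lintegral_swap hseg.aemeasurable]
    _ ≤ ‖v‖ₑ ^ p * ∫⁻ _ in Icc (0 : ℝ) 1, (∫⁻ y, g y ∂μ) := by
        refine mul_le_mul_right (lintegral_mono fun θ => ?_) _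
        exact (setLIntegral_le_lintegral _ _).trans_eq
          (lintegral_add_right_eq_self (μ := μ) g (θ • v))
    _ = _ := by simp [hg, energy, lintegral_indicator hO]

theorem lintegral_comp_add_smul_sub (g : F → ℝ≥0∞) (x : F) {θ : ℝ} (hθ : 0 < θ) :
    ∫⁻ y, g (x + θ • (y - x)) ∂μ =
      ENNReal.ofReal ((θ ^ Module.finrank ℝ F)⁻¹) * ∫⁻ y, g y ∂μ := by
  calc ∫⁻ y, g (x + θ • (y - x)) ∂μ = ∫⁻ y, g (x + θ • y) ∂μ :=
        lintegral_sub_right_eq_self (fun y => g (x + θ • y)) x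
    _ = ∫⁻ y, g (x + y) ∂(Measure.map (θ • ·) μ) :=
        ((Homeomorph.smulOfNeZero θ hθ.ne').measurableEmbedding.lintegral_map
          fun y => g (x + y)).symm
    _ = _ := by
        rw [Measure.map_addHaar_smul _ hθ.ne', lintegral_smul_measure, lintegral_add_left_eq_self,
          abs_of_pos (by positivity), smul_eq_mul]

variable {B : Set F} {g : F → ℝ≥0∞}

theorem lintegral_lintegral_add_smul_sub_le_of_half_le (hB : MeasurableSet B) (hc : Convex ℝ B)
    (g : F → ℝ≥0∞) {θ : ℝ} (hθ : θ ∈ Icc (2⁻¹ : ℝ) 1) :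
    ∫⁻ x in B, ∫⁻ y in B, g (x + θ • (y - x)) ∂μ ∂μ ≤
      μ B * (2 ^ Module.finrank ℝ F * ∫⁻ y in B, g y ∂μ) := by
  have hθ0 : 0 < θ := lt_of_lt_of_le (by norm_num) hθ.1
  have hjac : ENNReal.ofReal ((θ ^ Module.finrank ℝ F)⁻¹) ≤ 2 ^ Module.finrank ℝ F := by
    rw [← ENNReal.ofReal_ofNat, ← ENNReal.ofReal_pow zero_le_two, ← inv_pow]
    gcongr
    exact (inv_le_comm₀ hθ0 two_pos).2 hθ.1
  have hslice : ∀ x ∈ B,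
      ∫⁻ y in B, g (x + θ • (y - x)) ∂μ ≤ 2 ^ Module.finrank ℝ F * ∫⁻ y in B, g y ∂μ := by
    intro x hx
    calc ∫⁻ y in B, g (x + θ • (y - x)) ∂μ
        ≤ ∫⁻ y in B, B.indicator g (x + θ • (y - x)) ∂μ := by
          refine setLIntegral_mono' hB fun y hy => ?_
          rw [indicator_of_mem (hc.add_smul_sub_mem hx hy ⟨hθ0.le, hθ.2⟩)]
      _ ≤ ∫⁻ y, B.indicator g (x + θ • (y - x)) ∂μ := setLIntegral_le_lintegral _ _
      _ = ENNReal.ofReal ((θ ^ Module.finrank ℝ F)⁻¹) * ∫⁻ y in B, g y ∂μ := by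
          rw [lintegral_comp_add_smul_sub μ _ x hθ0, lintegral_indicator hB]
      _ ≤ _ := by gcongr
  calc _ ≤ ∫⁻ _ in B, 2 ^ Module.finrank ℝ F * ∫⁻ y in B, g y ∂μ ∂μ :=
        setLIntegral_mono' hB hslice
    _ = _ := by rw [lintegral_const, Measure.restrict_apply_univ, mul_comm]

theorem lintegral_lintegral_add_smul_sub_le (hB : MeasurableSet B) (hc : Convex ℝ B)
    (hg : Measurable g) {θ : ℝ} (hθ : θ ∈ Icc (0 : ℝ) 1) :
    ∫⁻ x in B, ∫⁻ y in B, g (x + θ • (y - x)) ∂μ ∂μ ≤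
      μ B * (2 ^ Module.finrank ℝ F * ∫⁻ y in B, g y ∂μ) := by
  rcases le_total 2⁻¹ θ with hhalf | hhalf
  · exact lintegral_lintegral_add_smul_sub_le_of_half_le μ hB hc g ⟨hhalf, hθ.2⟩
  · -- Exchanging `x` and `y` replaces `θ` by `1 - θ`.
    have hmeas : Measurable fun z : F × F => g (z.1 + θ • (z.2 - z.1)) := hg.comp (by fun_prop)
    rw [lintegral_lintegral_swap hmeas.aemeasurable]
    refine le_trans (le_of_eq ?_) (lintegral_lintegral_add_smul_sub_le_of_half_le μ hB hc g
      (θ := 1 - θ) ⟨by linarith, by linarith [hθ.1]⟩)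
    refine lintegral_congr fun y => lintegral_congr fun x => congrArg g ?_
    module

theorem lintegral_lintegral_segment_le (hB : MeasurableSet B) (hc : Convex ℝ B)
    (hg : Measurable g) :
    ∫⁻ x in B, ∫⁻ y in B, (∫⁻ θ in Icc (0 : ℝ) 1, g (x + θ • (y - x))) ∂μ ∂μ ≤
      μ B * (2 ^ Module.finrank ℝ F * ∫⁻ y in B, g y ∂μ) := by
  have hyθ (x : F) : Measurable fun z : F × ℝ => g (x + z.2 • (z.1 - x)) :=
    hg.comp (by fun_prop)
  have hxθ : Measurable fun z : F × ℝ => ∫⁻ y in B, g (z.1 + z.2 • (y - z.1)) ∂μ := by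
    have : Measurable fun z : (F × ℝ) × F => g (z.1.1 + z.1.2 • (z.2 - z.1.1)) :=
      hg.comp (by fun_prop)
    exact this.lintegral_prod_right'
  calc _ = ∫⁻ θ in Icc (0 : ℝ) 1, (∫⁻ x in B, ∫⁻ y in B, g (x + θ • (y - x)) ∂μ ∂μ) := by
        rw [lintegral_congr fun x => lintegral_lintegral_swap
          (f := fun y (θ : ℝ) => g (x + θ • (y - x))) (hyθ x).aemeasurable]
        exact lintegral_lintegral_swap hxθ.aemeasurable
    _ ≤ ∫⁻ _ in Icc (0 : ℝ) 1, (μ B * (2 ^ Module.finrank ℝ F * ∫⁻ y in B, g y ∂μ)) :=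
        setLIntegral_mono' measurableSet_Icc fun _ hθ =>
          lintegral_lintegral_add_smul_sub_le μ hB hc hg hθ
    _ = _ := by simp

theorem exists_lintegral_energy_sub_le_of_convex (hp : 1 ≤ p) (hB : MeasurableSet B)
    (hc : Convex ℝ B) (hbdd : Bornology.IsBounded B) :
    ∃ D ≠ (⊤ : ℝ≥0∞), ∀ η : F → G, ContDiff ℝ 1 η →
      ∫⁻ x in B, energy p (μ.restrict B) (fun y => η y - η x) ∂μ ≤
        D * energy p (μ.restrict B) (fderiv ℝ η) := by
  have hdiam : Metric.ediam B ^ p ≠ ⊤ :=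
    ENNReal.rpow_ne_top_of_nonneg (by linarith) (Metric.isBounded_iff_ediam_ne_top.1 hbdd)
  have hBtop : μ B ≠ ⊤ := hbdd.measure_lt_top.ne
  refine ⟨Metric.ediam B ^ p * (μ B * 2 ^ Module.finrank ℝ F), by finiteness, fun η hη => ?_⟩
  rw [mul_assoc, mul_assoc]
  refine le_trans ?_ (mul_le_mul_right (lintegral_lintegral_segment_le μ hB hc
    (measurable_enorm_fderiv_rpow hη p)) _)
  rw [← lintegral_const_mul' _ _ hdiam]
  refine setLIntegral_mono' hB fun x hx => ?_
  rw [← lintegral_const_mul' _ _ hdiam]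
  refine setLIntegral_mono' hB fun y hy => ?_
  have hincr := enorm_sub_rpow_le_lintegral_segment hp hη x (y - x) (t := 1) (by simp)
  rw [one_smul, add_sub_cancel] at hincr
  refine hincr.trans ?_
  gcongr
  rw [← edist_eq_enorm_sub]
  exact Metric.edist_le_ediam_of_mem hy hx

end Segment

section GradDominated

variable {F : Type*} [NormedAddCommGroup F] [NormedSpace ℝ F] [MeasurableSpace F] {p : ℝ}
  {μ μ' ν ν' ν'' : Measure F}

/-- The `ν'`-energy of continuously differentiable functions is dominated by their `ν`-energy
together with the `μ`-energy of their derivative. Trace and Poincaré inequalities have this form. -/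
def GradDominated (p : ℝ) (μ ν ν' : Measure F) : Prop :=
  ∃ C ≠ (⊤ : ℝ≥0∞), ∀ η : F → ℝ, ContDiff ℝ 1 η →
    energy p ν' η ≤ C * (energy p ν η + energy p μ (fderiv ℝ η))

theorem GradDominated.of_le (h : ν' ≤ ν) : GradDominated p μ ν ν' :=
  ⟨1, ENNReal.one_ne_top, fun η _ => by
    rw [one_mul]
    exact (energy_mono_measure h η).trans le_self_add⟩

theorem GradDominated.mono (h : GradDominated p μ ν ν') (hμ : μ ≤ μ') :
    GradDominated p μ' ν ν' := by
  obtain ⟨C, hC, hle⟩ := h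
  refine ⟨C, hC, fun η hη => (hle η hη).trans ?_⟩
  gcongr
  exact energy_mono_measure hμ _

theorem GradDominated.trans (h : GradDominated p μ ν ν') (h' : GradDominated p μ ν' ν'') :
    GradDominated p μ ν ν'' := by
  obtain ⟨C, hC, hle⟩ := h
  obtain ⟨C', hC', hle'⟩ := h'
  refine ⟨C' * (C + 1), by finiteness, fun η hη => (hle' η hη).trans ?_⟩
  rw [mul_assoc, add_mul, one_mul]
  gcongr
  exacts [hle η hη, le_add_self]

theorem GradDominated.restrict_union {S T : Set F} (hS : GradDominated p μ ν (ν'.restrict S))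
    (hT : GradDominated p μ ν (ν'.restrict T)) : GradDominated p μ ν (ν'.restrict (S ∪ T)) := by
  obtain ⟨C, hC, hle⟩ := hS
  obtain ⟨C', hC', hle'⟩ := hT
  refine ⟨C + C', by finiteness, fun η hη => (lintegral_union_le _ _ _).trans ?_⟩
  rw [add_mul]
  exact add_le_add (hle η hη) (hle' η hη)

theorem GradDominated.of_isCompact {S : Set F} (hS : IsCompact S)
    (h : ∀ x ∈ S, ∃ N ∈ 𝓝 x, GradDominated p μ ν (ν'.restrict N)) :
    GradDominated p μ ν (ν'.restrict S) := by
  refine hS.induction_on (p := fun S => GradDominated p μ ν (ν'.restrict S)) ?_ ?_ ?_ ?_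
  · exact .of_le (by simp [Measure.zero_le])
  · exact fun S T hST hT => hT.trans (.of_le (Measure.restrict_mono_set _ hST))
  · exact fun S T => GradDominated.restrict_union
  · intro x hx
    obtain ⟨N, hN, hdom⟩ := h x hx
    exact ⟨N, mem_nhdsWithin_of_mem_nhds hN, hdom⟩

variable [FiniteDimensional ℝ F] [BorelSpace F] [μ.IsAddHaarMeasure] {A B O : Set F}

theorem GradDominated.of_translate (hp : 1 ≤ p) (hA : MeasurableSet A) (hO : MeasurableSet O)
    {v : F} (hAB : MapsTo (· + v) A B)
    (hAO : ∀ y ∈ A, ∀ θ ∈ Icc (0 : ℝ) 1, y + θ • v ∈ O) :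
    GradDominated p (μ.restrict O) (μ.restrict B) (μ.restrict A) := by
  have h2 : (2 : ℝ≥0∞) ^ (p - 1) ≠ ⊤ := ENNReal.rpow_ne_top_of_nonneg (by linarith) (by simp)
  have hv : ‖v‖ₑ ^ p ≠ ⊤ := ENNReal.rpow_ne_top_of_nonneg (by linarith) (by simp)
  refine ⟨2 ^ (p - 1) * (1 + ‖v‖ₑ ^ p), by finiteness, fun η hη => ?_⟩
  have hshift : energy p (μ.restrict A) (fun y => η (y + v)) ≤ energy p (μ.restrict B) η := by
    have hmp := (measurePreserving_add_right μ v).restrict_preimage_emb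
      (Homeomorph.addRight v).measurableEmbedding B
    have hcomp := hmp.lintegral_comp_emb (Homeomorph.addRight v).measurableEmbedding
      fun y => ‖η y‖ₑ ^ p
    exact (lintegral_mono_set hAB).trans_eq hcomp
  calc energy p (μ.restrict A) η
      ≤ ∫⁻ y in A, 2 ^ (p - 1) * (‖η (y + v)‖ₑ ^ p + ‖η (y + v) - η y‖ₑ ^ p) ∂μ :=
        lintegral_mono fun y => enorm_rpow_le_two_rpow_mul_add hp _ _
    _ = 2 ^ (p - 1) * (energy p (μ.restrict A) (fun y => η (y + v)) +
          energy p (μ.restrict A) (fun y => η (y + v) - η y)) := by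
        have hm : Measurable fun y => ‖η (y + v)‖ₑ ^ p :=
          (hη.continuous.comp (by fun_prop)).enorm.measurable.pow_const p
        rw [lintegral_const_mul' _ _ h2, lintegral_add_left hm]
        rfl
    _ ≤ 2 ^ (p - 1) * (energy p (μ.restrict B) η +
          ‖v‖ₑ ^ p * energy p (μ.restrict O) (fderiv ℝ η)) := by
        gcongr
        exact energy_translate_sub_le μ hp hη v hA hO hAO
    _ ≤ 2 ^ (p - 1) * (1 + ‖v‖ₑ ^ p) *
          (energy p (μ.restrict B) η + energy p (μ.restrict O) (fderiv ℝ η)) := by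
        rw [mul_assoc]
        gcongr
        rw [add_mul, one_mul]
        exact add_le_add le_self_add (mul_le_mul_right le_add_self _)

theorem GradDominated.of_convex (hp : 1 ≤ p) (hB : MeasurableSet B) (hc : Convex ℝ B)
    (hbdd : Bornology.IsBounded B) (hAB : A ⊆ B) (hA : μ A ≠ 0) :
    GradDominated p (μ.restrict B) (μ.restrict A) (μ.restrict B) := by
  have h2 : (2 : ℝ≥0∞) ^ (p - 1) ≠ ⊤ := ENNReal.rpow_ne_top_of_nonneg (by linarith) (by simp)
  have hBtop : μ B ≠ ⊤ := hbdd.measure_lt_top.ne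
  have hAtop : μ A ≠ ⊤ := ne_top_of_le_ne_top hBtop (measure_mono hAB)
  obtain ⟨D, hD, hleD⟩ :=
    exists_lintegral_energy_sub_le_of_convex (G := ℝ) μ hp hB hc hbdd
  refine ⟨(μ A)⁻¹ * (2 ^ (p - 1) * (μ B + D)), by finiteness, fun η hη => ?_⟩
  have hm : Measurable fun x => ‖η x‖ₑ ^ p := hη.continuous.enorm.measurable.pow_const p
  rw [mul_assoc, ← ENNReal.mul_le_iff_le_inv hA hAtop]
  calc μ A * energy p (μ.restrict B) η = ∫⁻ _ in A, energy p (μ.restrict B) η ∂μ := by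
        rw [lintegral_const, Measure.restrict_apply_univ, mul_comm]
    _ ≤ ∫⁻ x in A, ∫⁻ y in B, 2 ^ (p - 1) * (‖η x‖ₑ ^ p + ‖η y - η x‖ₑ ^ p) ∂μ ∂μ := by
        refine lintegral_mono fun x => lintegral_mono fun y => ?_
        rw [enorm_sub_rev (η y)]
        exact enorm_rpow_le_two_rpow_mul_add hp _ _
    _ = 2 ^ (p - 1) * (μ B * energy p (μ.restrict A) η +
          ∫⁻ x in A, energy p (μ.restrict B) (fun y => η y - η x) ∂μ) := by
        simp_rw [lintegral_const_mul' _ _ h2, lintegral_add_left measurable_const,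
          lintegral_const, Measure.restrict_apply_univ]
        rw [lintegral_add_left (hm.mul_const _), lintegral_mul_const _ hm, mul_comm (μ B)]
        rfl
    _ ≤ 2 ^ (p - 1) * (μ B * energy p (μ.restrict A) η +
          D * energy p (μ.restrict B) (fderiv ℝ η)) := by
        gcongr
        exact (lintegral_mono_set hAB).trans (hleD η hη)
    _ ≤ 2 ^ (p - 1) * (μ B + D) *
          (energy p (μ.restrict A) η + energy p (μ.restrict B) (fderiv ℝ η)) := by
        rw [mul_assoc, mul_add (μ B + D)]
        gcongr
        exacts [le_self_add, le_add_self]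

theorem exists_mem_nhds_gradDominated_of_isPreconnected (hp : 1 ≤ p) (hconn : IsPreconnected O)
    (hO : IsOpen O) (hB : IsOpen B) (hBne : B.Nonempty) (hBO : B ⊆ O) {x : F} (hx : x ∈ O) :
    ∃ N ∈ 𝓝 x, GradDominated p (μ.restrict O) (μ.restrict B) (μ.restrict N) := by
  set U : Set F :=
    {x | ∃ N ∈ 𝓝 x, GradDominated p (μ.restrict O) (μ.restrict B) (μ.restrict N)}
  obtain ⟨x₀, hx₀⟩ := hBne
  suffices h : O ⊆ U from h hx
  refine hconn.subset_of_closure_inter_subset ?_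
    ⟨x₀, hBO hx₀, B, hB.mem_nhds hx₀, .of_le le_rfl⟩ ?_
  · rw [isOpen_iff_mem_nhds]
    rintro y ⟨N, hN, hdom⟩
    filter_upwards [eventually_mem_nhds_iff.2 hN] with w hw using ⟨N, hw, hdom⟩
  · -- Nearby points of `U` hand their control over to a ball around `y` inside `O`.
    rintro y ⟨hyc, hyO⟩
    obtain ⟨r, hr, hrO⟩ := Metric.isOpen_iff.1 hO y hyO
    obtain ⟨w, hwb, N, hN, hdom⟩ := mem_closure_iff.1 hyc _ Metric.isOpen_ball
      (Metric.mem_ball_self hr)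
    have hpos : μ (interior N ∩ Metric.ball y r) ≠ 0 :=
      ((isOpen_interior.inter Metric.isOpen_ball).measure_pos μ
        ⟨w, mem_interior_iff_mem_nhds.2 hN, hwb⟩).ne'
    refine ⟨Metric.ball y r, Metric.ball_mem_nhds y hr, ?_⟩
    have hsub : μ.restrict (interior N ∩ Metric.ball y r) ≤ μ.restrict N :=
      Measure.restrict_mono_set _ (inter_subset_left.trans interior_subset)
    exact (hdom.trans (.of_le hsub)).trans ((GradDominated.of_convex hp measurableSet_ball
      (convex_ball y r) Metric.isBounded_ball inter_subset_right hpos).mono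
        (Measure.restrict_mono_set _ hrO))

theorem GradDominated.exists_energy_sub_const_le (hp : 1 ≤ p) (hB : MeasurableSet B)
    (hc : Convex ℝ B) (hbdd : Bornology.IsBounded B) (hB0 : μ B ≠ 0) (hBO : B ⊆ O)
    (h : GradDominated p (μ.restrict O) (μ.restrict B) (μ.restrict O)) :
    ∃ C ≠ (⊤ : ℝ≥0∞), ∀ η : F → ℝ, ContDiff ℝ 1 η → ∃ c : ℝ,
      energy p (μ.restrict O) (fun x => η x - c) ≤
        C * energy p (μ.restrict O) (fderiv ℝ η) := by
  obtain ⟨C, hC, hle⟩ := h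
  have hBtop : μ B ≠ ⊤ := hbdd.measure_lt_top.ne
  obtain ⟨D, hD, hleD⟩ :=
    exists_lintegral_energy_sub_le_of_convex (G := ℝ) μ hp hB hc hbdd
  refine ⟨C * ((μ B)⁻¹ * D + 1), by finiteness, fun η hη => ?_⟩
  have hm : Measurable fun z : F × F => ‖η z.2 - η z.1‖ₑ ^ p :=
    ((hη.continuous.comp continuous_snd).sub
      (hη.continuous.comp continuous_fst)).enorm.measurable.pow_const p
  obtain ⟨y, -, hy⟩ := exists_le_setLAverage
    (f := fun x => energy p (μ.restrict B) (fun y => η y - η x)) hB0 hBtop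
    hm.lintegral_prod_right'.aemeasurable
  refine ⟨η y, (hle (fun x => η x - η y) (hη.sub contDiff_const)).trans ?_⟩
  have hfderiv : fderiv ℝ (fun x => η x - η y) = fderiv ℝ η :=
    funext fun x => fderiv_sub_const _
  rw [hfderiv, mul_assoc, add_mul, one_mul, mul_assoc]
  gcongr
  refine hy.trans ?_
  rw [setLAverage_eq, ENNReal.div_eq_inv_mul]
  gcongr
  refine (hleD η hη).trans ?_
  gcongr
  exact energy_mono_measure (Measure.restrict_mono_set _ hBO) _

end GradDominated

section Graph

variable {F : Type*} [NormedAddCommGroup F] [InnerProductSpace ℝ F] {e : F}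

/-- The parametrization of the graph of `γ`, in the direction `e`, over the hyperplane orthogonal
to `e`. -/
def graphMap (e : F) (γ : (ℝ ∙ e)ᗮ → ℝ) (z : (ℝ ∙ e)ᗮ) : F := (z : F) + γ z • e

variable {γ : (ℝ ∙ e)ᗮ → ℝ} {K : ℝ≥0}

theorem lipschitzWith_graphMap (he : ‖e‖ = 1) (hγ : LipschitzWith K γ) :
    LipschitzWith (1 + K) (graphMap e γ) := by
  refine (LipschitzWith.subtype_val _).add (LipschitzWith.of_dist_le_mul fun x y => ?_)
  rw [dist_eq_norm, ← sub_smul, norm_smul, he, mul_one, ← dist_eq_norm]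
  exact hγ.dist_le_mul x y

theorem graphMap_orthogonalProjectionOnto (he : ‖e‖ = 1) {y : F}
    (h : γ ((ℝ ∙ e)ᗮ.orthogonalProjectionOnto y) = inner ℝ e y) :
    graphMap e γ ((ℝ ∙ e)ᗮ.orthogonalProjectionOnto y) = y := by
  rw [graphMap, h, Submodule.orthogonalProjectionOnto_orthogonal]
  simp [Submodule.starProjection_unit_singleton ℝ he]

variable [MeasurableSpace F] [BorelSpace F] {S O : Set F}

theorem lintegral_segment_graphMap_le (hO : MeasurableSet O) {h : ℝ} (hh : 0 < h)
    {g : F → ℝ≥0∞} (hg : Measurable g) {z : (ℝ ∙ e)ᗮ}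
    (hz : ∀ θ ∈ Ioc (0 : ℝ) 1, graphMap e γ z + θ • h • e ∈ O) :
    ∫⁻ θ in Icc (0 : ℝ) 1, g (graphMap e γ z + θ • h • e) ≤
      ENNReal.ofReal h⁻¹ * ∫⁻ τ : ℝ, O.indicator g ((z : F) + τ • e) := by
  have hline : Measurable fun τ : ℝ => O.indicator g ((z : F) + (γ z + τ) • e) :=
    (hg.indicator hO).comp (by fun_prop)
  calc ∫⁻ θ in Icc (0 : ℝ) 1, g (graphMap e γ z + θ • h • e)
      = ∫⁻ θ in Ioc (0 : ℝ) 1, g (graphMap e γ z + θ • h • e) := by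
        rw [restrict_Ioc_eq_restrict_Icc]
    _ ≤ ∫⁻ θ in Ioc (0 : ℝ) 1, O.indicator g ((z : F) + (γ z + h • θ) • e) := by
        refine setLIntegral_mono' measurableSet_Ioc fun θ hθ => ?_
        have heq : (z : F) + (γ z + h • θ) • e = graphMap e γ z + θ • h • e := by
          rw [graphMap, smul_eq_mul]
          module
        rw [heq, indicator_of_mem (hz θ hθ)]
    _ ≤ ∫⁻ θ : ℝ, O.indicator g ((z : F) + (γ z + h • θ) • e) := setLIntegral_le_lintegral _ _
    _ = ENNReal.ofReal h⁻¹ * ∫⁻ τ, O.indicator g ((z : F) + (γ z + τ) • e) := by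
        rw [← lintegral_map (f := fun τ : ℝ => O.indicator g ((z : F) + (γ z + τ) • e))
          (g := fun θ : ℝ => h • θ) hline (by fun_prop), Measure.map_addHaar_smul _ hh.ne',
          lintegral_smul_measure]
        simp [abs_of_pos hh]
    _ = ENNReal.ofReal h⁻¹ * ∫⁻ τ, O.indicator g ((z : F) + τ • e) := by
        rw [lintegral_add_left_eq_self (fun τ => O.indicator g ((z : F) + τ • e))]

variable [FiniteDimensional ℝ F]

theorem lintegral_eq_lintegral_orthogonal (he : ‖e‖ = 1) {g : F → ℝ≥0∞} (hg : Measurable g) :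
    ∫⁻ x, g x = ∫⁻ z : (ℝ ∙ e)ᗮ, ∫⁻ τ : ℝ, g ((z : F) + τ • e) := by
  have hsplit := (Submodule.measurePreserving_measurableEquivProd (ℝ ∙ e) (0 : F)).symm
  rw [InnerProductSpace.euclideanHausdorffMeasure_eq_volume] at hsplit
  have hline := (LinearIsometryEquiv.toSpanUnitSingleton (𝕜 := ℝ) e he).measurePreserving
  have hprod := hsplit.comp (hline.prod (MeasurePreserving.id (volume : Measure (ℝ ∙ e)ᗮ)))
  rw [← hprod.lintegral_comp hg]
  refine (lintegral_prod_symm' _ (hg.comp hprod.measurable)).trans ?_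
  refine lintegral_congr fun z => lintegral_congr fun τ => ?_
  simp [add_comm]

variable {n : ℕ}

theorem hausdorff_le_of_subset_range_graphMap (hn : Module.finrank ℝ (ℝ ∙ e)ᗮ = n)
    (he : ‖e‖ = 1) (hγ : LipschitzWith K γ) (hS : S ⊆ range (graphMap e γ)) :
    μHE[n] S ≤ ((1 + K) ^ n : ℝ≥0) * volume (graphMap e γ ⁻¹' S) := by
  have himage := (lipschitzWith_graphMap he hγ).hausdorffMeasure_image_le
    (d := (n : ℝ)) (by positivity) (graphMap e γ ⁻¹' S)
  rw [image_preimage_eq_of_subset hS] at himage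
  rw [← InnerProductSpace.euclideanHausdorffMeasure_eq_volume, hn,
    Measure.euclideanHausdorffMeasure_def, Measure.euclideanHausdorffMeasure_def,
    Measure.smul_apply, Measure.smul_apply, ENNReal.smul_def, ENNReal.smul_def, smul_eq_mul,
    smul_eq_mul, mul_left_comm]
  refine mul_le_mul_right (himage.trans_eq ?_) _
  simp

theorem setLIntegral_hausdorff_le_of_subset_range_graphMap
    (hn : Module.finrank ℝ (ℝ ∙ e)ᗮ = n) (he : ‖e‖ = 1) (hγ : LipschitzWith K γ)
    (hS : S ⊆ range (graphMap e γ)) {g : F → ℝ≥0∞} (hg : Measurable g) :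
    ∫⁻ y in S, g y ∂μHE[n] ≤
      ((1 + K) ^ n : ℝ≥0) * ∫⁻ z in graphMap e γ ⁻¹' S, g (graphMap e γ z) := by
  have hm : Measurable (graphMap e γ) := (lipschitzWith_graphMap he hγ).continuous.measurable
  have hle : (μHE[n] : Measure F).restrict S ≤ (((1 + K) ^ n : ℝ≥0) : ℝ≥0∞) •
      ((volume.restrict (graphMap e γ ⁻¹' S)).map (graphMap e γ)) := by
    refine Measure.le_intro fun B hB _ => ?_
    rw [Measure.restrict_apply hB, Measure.smul_apply, Measure.map_apply hm hB,
      Measure.restrict_apply (hm hB), smul_eq_mul, ← preimage_inter]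
    exact hausdorff_le_of_subset_range_graphMap hn he hγ (inter_subset_right.trans hS)
  refine (lintegral_mono' hle le_rfl).trans ?_
  rw [lintegral_smul_measure, lintegral_map hg hm, smul_eq_mul]

theorem lintegral_hausdorff_segment_le (hn : Module.finrank ℝ (ℝ ∙ e)ᗮ = n)
    (he : ‖e‖ = 1) (hγ : LipschitzWith K γ)
    (hS : MeasurableSet S) (hO : MeasurableSet O) (hSr : S ⊆ range (graphMap e γ)) {h : ℝ}
    (hh : 0 < h) (hSO : ∀ y ∈ S, ∀ θ ∈ Ioc (0 : ℝ) 1, y + θ • h • e ∈ O) {g : F → ℝ≥0∞}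
    (hg : Measurable g) :
    ∫⁻ y in S, (∫⁻ θ in Icc (0 : ℝ) 1, g (y + θ • h • e)) ∂μHE[n] ≤
      ((1 + K) ^ n : ℝ≥0) * (ENNReal.ofReal h⁻¹ * ∫⁻ x in O, g x) := by
  have hm : Measurable (graphMap e γ) := (lipschitzWith_graphMap he hγ).continuous.measurable
  have hgm : Measurable fun z : F × ℝ => g (z.1 + z.2 • h • e) := hg.comp (by fun_prop)
  refine (setLIntegral_hausdorff_le_of_subset_range_graphMap hn he hγ hSr
    hgm.lintegral_prod_right').trans (mul_le_mul_right ?_ _)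
  rw [← lintegral_indicator hO, lintegral_eq_lintegral_orthogonal he (hg.indicator hO),
    ← lintegral_const_mul' _ _ ENNReal.ofReal_ne_top]
  exact (setLIntegral_mono' (hm hS) fun z hz =>
    lintegral_segment_graphMap_le hO hh hg (hSO _ hz)).trans (setLIntegral_le_lintegral _ _)

theorem GradDominated.of_subset_range_graphMap {p : ℝ}
    (hn : Module.finrank ℝ (ℝ ∙ e)ᗮ = n) (hp : 1 ≤ p) (he : ‖e‖ = 1)
    (hγ : LipschitzWith K γ) (hS : MeasurableSet S) (hO : MeasurableSet O)
    (hSr : S ⊆ range (graphMap e γ)) {h : ℝ} (hh : 0 < h)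
    (hSO : ∀ y ∈ S, ∀ θ ∈ Ioc (0 : ℝ) 1, y + θ • h • e ∈ O) :
    GradDominated p (volume.restrict O) (volume.restrict O) (μHE[n].restrict S) := by
  have h2 : (2 : ℝ≥0∞) ^ (p - 1) ≠ ⊤ := ENNReal.rpow_ne_top_of_nonneg (by linarith) (by simp)
  have hv : ‖h • e‖ₑ ^ p ≠ ⊤ := ENNReal.rpow_ne_top_of_nonneg (by linarith) (by simp)
  refine ⟨2 ^ (p - 1) * (((1 + K) ^ n : ℝ≥0) * (ENNReal.ofReal h⁻¹ * (1 + ‖h • e‖ₑ ^ p))),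
    by finiteness, fun η hη => ?_⟩
  have hval : Measurable fun w => ‖η w‖ₑ ^ p := hη.continuous.enorm.measurable.pow_const p
  have hmeas : Measurable fun w => ‖η w‖ₑ ^ p + ‖h • e‖ₑ ^ p * ‖fderiv ℝ η w‖ₑ ^ p :=
    hval.add ((measurable_enorm_fderiv_rpow hη p).const_mul _)
  calc energy p (μHE[n].restrict S) η
      ≤ ∫⁻ y in S, 2 ^ (p - 1) * (∫⁻ θ in Icc (0 : ℝ) 1, (‖η (y + θ • h • e)‖ₑ ^ p +
          ‖h • e‖ₑ ^ p * ‖fderiv ℝ η (y + θ • h • e)‖ₑ ^ p)) ∂μHE[n] :=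
        lintegral_mono fun y => enorm_rpow_le_lintegral_segment hp hη y (h • e)
    _ ≤ 2 ^ (p - 1) * (((1 + K) ^ n : ℝ≥0) * (ENNReal.ofReal h⁻¹ *
          ∫⁻ x in O, (‖η x‖ₑ ^ p + ‖h • e‖ₑ ^ p * ‖fderiv ℝ η x‖ₑ ^ p))) := by
        rw [lintegral_const_mul' _ _ h2]
        gcongr
        exact lintegral_hausdorff_segment_le hn he hγ hS hO hSr hh hSO hmeas
    _ ≤ 2 ^ (p - 1) * (((1 + K) ^ n : ℝ≥0) * (ENNReal.ofReal h⁻¹ * ((1 + ‖h • e‖ₑ ^ p) *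
          (energy p (volume.restrict O) η + energy p (volume.restrict O) (fderiv ℝ η))))) := by
        gcongr
        rw [lintegral_add_left hval, lintegral_const_mul' _ _ hv, add_mul, one_mul]
        exact add_le_add le_self_add (mul_le_mul_right le_add_self _)
    _ = _ := by ring

end Graph

section LipschitzBoundary

variable {d : ℕ} {Ω : Set (E d)} {x : E d}

/-- A chart of the boundary of `Ω` at `x`: in the ball of the given radius around `x`, the set `Ω`
is the strict epigraph, in the direction `axis`, of the Lipschitz function `height`. -/
structure BoundaryChart (Ω : Set (E d)) (x : E d) where
  axis : E d
  norm_axis : ‖axis‖ = 1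
  height : (ℝ ∙ axis)ᗮ → ℝ
  lip : ℝ≥0
  lipschitzWith_height : LipschitzWith lip height
  radius : ℝ
  radius_pos : 0 < radius
  mem_iff {y : E d} : y ∈ Metric.ball x radius →
    (y ∈ Ω ↔ height ((ℝ ∙ axis)ᗮ.orthogonalProjectionOnto y) < inner ℝ axis y)

theorem HasLipschitzBoundary.nonempty_boundaryChart (h : HasLipschitzBoundary Ω)
    (hx : x ∈ frontier Ω) : Nonempty (BoundaryChart Ω x) := by
  obtain ⟨e, K, γ, he, hγ, hev⟩ := h x hx
  obtain ⟨R, hR, hball⟩ := Metric.eventually_nhds_iff_ball.1 hev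
  exact ⟨⟨e, he, γ, K, hγ, R, hR, hball _⟩⟩

namespace BoundaryChart

variable (c : BoundaryChart Ω x) {y : E d}

theorem half_radius_pos : 0 < c.radius / 2 := half_pos c.radius_pos

theorem finrank_orthogonal_axis : Module.finrank ℝ (ℝ ∙ c.axis)ᗮ = d - 1 := by
  have hne : c.axis ≠ 0 := norm_ne_zero_iff.1 (by simp [c.norm_axis])
  have h := (ℝ ∙ c.axis).finrank_add_finrank_orthogonal
  rw [finrank_span_singleton hne, finrank_euclideanSpace_fin] at h
  omega

theorem height_le_of_mem_closure (hy : y ∈ Metric.ball x c.radius) (hyΩ : y ∈ closure Ω) :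
    c.height ((ℝ ∙ c.axis)ᗮ.orthogonalProjectionOnto y) ≤ inner ℝ c.axis y := by
  by_contra! hlt
  have hopen : IsOpen
      {y | inner ℝ c.axis y < c.height ((ℝ ∙ c.axis)ᗮ.orthogonalProjectionOnto y)} :=
    isOpen_lt (by fun_prop) (c.lipschitzWith_height.continuous.comp (by fun_prop))
  obtain ⟨w, hw, hwΩ⟩ := mem_closure_iff.1 hyΩ _ (hopen.inter Metric.isOpen_ball) ⟨hlt, hy⟩
  exact lt_asymm hw.1 ((c.mem_iff hw.2).1 hwΩ)

theorem mem_range_graphMap (hΩ : IsOpen Ω) (hy : y ∈ Metric.ball x c.radius)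
    (hyΩ : y ∈ frontier Ω) : y ∈ range (graphMap c.axis c.height) := by
  have hnot : y ∉ Ω := by
    rw [hΩ.frontier_eq] at hyΩ
    exact hyΩ.2
  exact ⟨_, graphMap_orthogonalProjectionOnto c.norm_axis
    (le_antisymm (c.height_le_of_mem_closure hy (frontier_subset_closure hyΩ))
      (not_lt.1 fun h => hnot ((c.mem_iff hy).2 h)))⟩

theorem closedBall_add_smul_subset (hy : y ∈ Metric.ball x (c.radius / 2)) (hyΩ : y ∈ closure Ω)
    {t δ : ℝ} (hδt : (1 + c.lip) * δ < t) (ht : t + δ ≤ c.radius / 2) :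
    Metric.closedBall (y + t • c.axis) δ ⊆ Ω := by
  intro w hw
  rw [Metric.mem_closedBall] at hw
  have hδ : 0 ≤ δ := dist_nonneg.trans hw
  have ht0 : 0 < t := lt_of_le_of_lt (by positivity) hδt
  have hshift : dist (y + t • c.axis) y = t := by
    rw [dist_self_add_left, norm_smul, c.norm_axis, mul_one, Real.norm_of_nonneg ht0.le]
  have hwR : w ∈ Metric.ball x c.radius := by
    have := dist_triangle4 w (y + t • c.axis) y x
    rw [Metric.mem_ball] at hy ⊢
    linarith
  have hinner : inner ℝ c.axis y + t - δ ≤ inner ℝ c.axis w := by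
    have h := real_inner_le_norm c.axis (y + t • c.axis - w)
    rw [inner_sub_right, inner_add_right, inner_smul_right, real_inner_self_eq_norm_sq,
      c.norm_axis, ← dist_eq_norm, dist_comm] at h
    linarith
  have hproj : (ℝ ∙ c.axis)ᗮ.orthogonalProjectionOnto (y + t • c.axis) =
      (ℝ ∙ c.axis)ᗮ.orthogonalProjectionOnto y := by
    rw [map_add, map_smul,
      Submodule.orthogonalProjectionOnto_orthogonalComplement_singleton_eq_zero, smul_zero,
      add_zero]
  have hheight : c.height ((ℝ ∙ c.axis)ᗮ.orthogonalProjectionOnto w) -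
      c.height ((ℝ ∙ c.axis)ᗮ.orthogonalProjectionOnto y) ≤ c.lip * δ := by
    refine (le_abs_self _).trans ((c.lipschitzWith_height.dist_le_mul _ _).trans ?_)
    gcongr
    rw [← hproj, dist_eq_norm, ← map_sub]
    refine ((ℝ ∙ c.axis)ᗮ.norm_orthogonalProjectionOnto_apply_le _).trans ?_
    rwa [← dist_eq_norm]
  have := c.height_le_of_mem_closure
    (Metric.ball_subset_ball (by linarith [c.radius_pos]) hy) hyΩ
  rw [c.mem_iff hwR]
  linarith

theorem add_smul_mem (hy : y ∈ Metric.ball x (c.radius / 2)) (hyΩ : y ∈ closure Ω)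
    {t : ℝ} (ht0 : 0 < t) (ht : t ≤ c.radius / 2) : y + t • c.axis ∈ Ω :=
  c.closedBall_add_smul_subset hy hyΩ (δ := 0) (by simpa) (by simpa)
    (Metric.mem_closedBall_self le_rfl)

theorem add_smul_smul_mem (hy : y ∈ Metric.ball x (c.radius / 2)) (hyΩ : y ∈ closure Ω)
    {θ : ℝ} (hθ : θ ∈ Ioc (0 : ℝ) 1) : y + θ • (c.radius / 2) • c.axis ∈ Ω := by
  rw [smul_smul]
  exact c.add_smul_mem hy hyΩ (mul_pos hθ.1 c.half_radius_pos)
    (mul_le_of_le_one_left c.half_radius_pos.le hθ.2)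

end BoundaryChart

/-- Bounded Lipschitz domains, not necessarily connected. -/
structure IsBoundedLipschitz (Ω : Set (E d)) : Prop where
  isOpen : IsOpen Ω
  isBounded : Bornology.IsBounded Ω
  hasLipschitzBoundary : HasLipschitzBoundary Ω

variable {p : ℝ}

theorem exists_mem_nhds_gradDominated_surf (hΩ : IsOpen Ω) (hlip : HasLipschitzBoundary Ω)
    (hp : 1 ≤ p) (hx : x ∈ frontier Ω) :
    ∃ N ∈ 𝓝 x, GradDominated p (vol Ω) (vol Ω) ((surf Ω).restrict N) := by
  obtain ⟨c⟩ := hlip.nonempty_boundaryChart hx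
  refine ⟨Metric.ball x (c.radius / 2), Metric.ball_mem_nhds x c.half_radius_pos, ?_⟩
  rw [Measure.restrict_restrict measurableSet_ball]
  refine GradDominated.of_subset_range_graphMap c.finrank_orthogonal_axis hp c.norm_axis
    c.lipschitzWith_height (measurableSet_ball.inter isClosed_frontier.measurableSet)
    hΩ.measurableSet ?_ c.half_radius_pos ?_
  · rintro y ⟨hy, hyΩ⟩
    exact c.mem_range_graphMap hΩ
      (Metric.ball_subset_ball (half_le_self c.radius_pos.le) hy) hyΩ
  · rintro y ⟨hy, hyΩ⟩ θ hθ
    exact c.add_smul_smul_mem hy (frontier_subset_closure hyΩ) hθ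

theorem IsBoundedLipschitz.gradDominated_surf (hΩ : IsBoundedLipschitz Ω) (hp : 1 ≤ p) :
    GradDominated p (vol Ω) (vol Ω) (surf Ω) := by
  have hcomp : IsCompact (frontier Ω) := Metric.isCompact_of_isClosed_isBounded isClosed_frontier
    (hΩ.isBounded.closure.subset frontier_subset_closure)
  have h := GradDominated.of_isCompact hcomp fun x hx =>
    exists_mem_nhds_gradDominated_surf hΩ.isOpen hΩ.hasLipschitzBoundary hp hx
  rwa [Measure.restrict_restrict isClosed_frontier.measurableSet, inter_self] at h

theorem IsBoundedLipschitz.surf_univ_lt_top (hΩ : IsBoundedLipschitz Ω) : surf Ω univ < ⊤ := by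
  obtain ⟨C, hC, hle⟩ := hΩ.gradDominated_surf le_rfl
  have h : surf Ω univ ≤ C * volume Ω := by
    have hzero : ‖(0 : E d →L[ℝ] ℝ)‖ₑ = 0 := by simp [← ofReal_norm]
    simpa [energy, hzero] using hle (fun _ => 1) contDiff_const
  exact h.trans_lt (ENNReal.mul_lt_top hC.lt_top hΩ.isBounded.measure_lt_top)

theorem exists_mem_nhds_gradDominated_of_mem_frontier (hΩ : IsOpen Ω)
    (hlip : HasLipschitzBoundary Ω) (hp : 1 ≤ p) (hconn : IsPreconnected Ω) {B : Set (E d)}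
    (hB : IsOpen B) (hBne : B.Nonempty) (hBΩ : B ⊆ Ω) (hx : x ∈ frontier Ω) :
    ∃ N ∈ 𝓝 x, GradDominated p (vol Ω) (vol B) ((vol Ω).restrict N) := by
  obtain ⟨c⟩ := hlip.nonempty_boundaryChart hx
  set v : E d := (c.radius / 2) • c.axis
  have hxv : x + v ∈ Ω := c.add_smul_mem (Metric.mem_ball_self c.half_radius_pos)
    (frontier_subset_closure hx) c.half_radius_pos le_rfl
  obtain ⟨N, hN, hdom⟩ :=
    exists_mem_nhds_gradDominated_of_isPreconnected (μ := volume) hp hconn hΩ hB hBne hBΩ hxv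
  obtain ⟨ρ, hρ, hρN⟩ := Metric.mem_nhds_iff.1 hN
  have hr : 0 < min ρ (c.radius / 2) := lt_min hρ c.half_radius_pos
  refine ⟨Metric.ball x (min ρ (c.radius / 2)), Metric.ball_mem_nhds x hr, ?_⟩
  rw [Measure.restrict_restrict measurableSet_ball]
  refine hdom.trans (.of_translate hp (measurableSet_ball.inter hΩ.measurableSet)
    hΩ.measurableSet (v := v) ?_ ?_)
  · rintro y ⟨hy, -⟩
    exact hρN (by simpa using Metric.ball_subset_ball (min_le_left _ _) hy)
  · rintro y ⟨hy, hyΩ⟩ θ hθ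
    rcases hθ.1.eq_or_lt with rfl | hpos
    · simpa using hyΩ
    · exact c.add_smul_smul_mem (Metric.ball_subset_ball (min_le_right _ _) hy)
        (subset_closure hyΩ) ⟨hpos, hθ.2⟩

theorem IsBoundedLipschitz.gradDominated_of_isPreconnected (hΩ : IsBoundedLipschitz Ω)
    (hp : 1 ≤ p) (hconn : IsPreconnected Ω) {B : Set (E d)} (hB : IsOpen B) (hBne : B.Nonempty)
    (hBΩ : B ⊆ Ω) : GradDominated p (vol Ω) (vol B) (vol Ω) := by
  have h : GradDominated p (vol Ω) (vol B) ((vol Ω).restrict (closure Ω)) := by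
    refine .of_isCompact hΩ.isBounded.isCompact_closure fun x hx => ?_
    by_cases hxΩ : x ∈ Ω
    · obtain ⟨N, hN, hdom⟩ := exists_mem_nhds_gradDominated_of_isPreconnected (μ := volume) hp
        hconn hΩ.isOpen hB hBne hBΩ hxΩ
      exact ⟨N, hN, hdom.trans (.of_le (Measure.restrict_mono_measure Measure.restrict_le_self _))⟩
    · refine exists_mem_nhds_gradDominated_of_mem_frontier hΩ.isOpen hΩ.hasLipschitzBoundary hp
        hconn hB hBne hBΩ ?_
      rw [hΩ.isOpen.frontier_eq]
      exact ⟨hx, hxΩ⟩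
  rwa [Measure.restrict_restrict isClosed_closure.measurableSet,
    inter_eq_right.2 subset_closure] at h

theorem IsBoundedLipschitz.exists_energy_sub_const_le (hΩ : IsBoundedLipschitz Ω)
    (hp : 1 ≤ p) (hconn : IsConnected Ω) :
    ∃ C ≠ (⊤ : ℝ≥0∞), ∀ η : E d → ℝ, ContDiff ℝ 1 η → ∃ c : ℝ,
      energy p (vol Ω) (fun x => η x - c) ≤ C * energy p (vol Ω) (fderiv ℝ η) := by
  obtain ⟨x₀, hx₀⟩ := hconn.nonempty
  obtain ⟨r, hr, hB⟩ := Metric.isOpen_iff.1 hΩ.isOpen x₀ hx₀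
  exact (hΩ.gradDominated_of_isPreconnected hp hconn.isPreconnected Metric.isOpen_ball
    ⟨x₀, Metric.mem_ball_self hr⟩ hB).exists_energy_sub_const_le hp measurableSet_ball
    (convex_ball x₀ r) Metric.isBounded_ball (Metric.measure_ball_pos volume x₀ hr).ne' hB

end LipschitzBoundary

section Mollification

open scoped Convolution
open ContinuousLinearMap (lsmul)

variable {F X : Type*} [NormedAddCommGroup F] [NormedSpace ℝ F] [FiniteDimensional ℝ F]
  [MeasurableSpace F] [BorelSpace F] {μ : Measure F} [μ.IsAddHaarMeasure] [NormedAddCommGroup X]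
  {s : ℝ≥0∞}

theorem tendsto_eLpNorm_translate_sub [Fact (1 ≤ s)] (hs : s ≠ ⊤) {f : F → X} (hf : MemLp f s μ) :
    Tendsto (fun z => eLpNorm (fun y => f (y - z) - f y) s μ) (𝓝 0) (𝓝 0) := by
  have hmp (z : F) : MeasurePreserving (fun y => y - z) μ μ := measurePreserving_sub_right μ z
  let T (z : F) : C(F, F) := ⟨fun y => y - z, by fun_prop⟩
  have hT : Continuous T := by
    refine ContinuousMap.continuous_of_continuous_uncurry _ ?_
    simp only [T, Function.uncurry_def, ContinuousMap.coe_mk]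
    fun_prop
  have hcont : Tendsto (fun z => Lp.compMeasurePreserving (T z) (hmp z) (hf.toLp f)) (𝓝 0)
      (𝓝 (Lp.compMeasurePreserving (T 0) (hmp 0) (hf.toLp f))) :=
    tendsto_const_nhds.compMeasurePreservingLp (hT.tendsto 0) hmp (hmp 0) hs
  simpa [T, tendsto_iff_edist_tendsto_0, Lp.toLp_compMeasurePreserving, Lp.edist_toLp_toLp,
    Function.comp_def, Pi.sub_def] using hcont

theorem eLpNorm_rpow_toReal_eq_energy {α : Type*} [MeasurableSpace α] {ν : Measure α} (hs0 : s ≠ 0)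
    (hs : s ≠ ⊤) (f : α → X) : eLpNorm f s ν ^ s.toReal = energy s.toReal ν f := by
  rw [eLpNorm_eq_lintegral_rpow_enorm_toReal hs0 hs, ← ENNReal.rpow_mul, one_div,
    inv_mul_cancel₀ (ENNReal.toReal_pos hs0 hs).ne', ENNReal.rpow_one, energy]

section Density

variable [NormedSpace ℝ X] [CompleteSpace X] {f : F → X} {ψ : F → ℝ}

/-- Jensen's inequality for the probability measure with density `ψ`. -/
theorem enorm_convolution_sub_rpow_le {p : ℝ} (hp : 1 ≤ p) (hf : StronglyMeasurable f)
    (hfloc : LocallyIntegrable f μ) (hψ : Continuous ψ) (hψc : HasCompactSupport ψ)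
    (hψ0 : ∀ z, 0 ≤ ψ z) (hψ1 : ∫ z, ψ z ∂μ = 1) (y : F) :
    ‖(ψ ⋆[lsmul ℝ ℝ, μ] f) y - f y‖ₑ ^ p ≤
      ∫⁻ z, ENNReal.ofReal (ψ z) * ‖f (y - z) - f y‖ₑ ^ p ∂μ := by
  have hψi : Integrable ψ μ := hψ.integrable_of_hasCompactSupport hψc
  have hw : Measurable fun z => ENNReal.ofReal (ψ z) := hψ.measurable.ennreal_ofReal
  have hprob : IsProbabilityMeasure (μ.withDensity fun z => ENNReal.ofReal (ψ z)) :=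
    ⟨by rw [withDensity_apply _ .univ, Measure.restrict_univ,
      ← ofReal_integral_eq_lintegral_ofReal hψi (.of_forall hψ0), hψ1, ENNReal.ofReal_one]⟩
  have hsub : Measurable fun z => ‖f (y - z) - f y‖ₑ :=
    ((hf.comp_measurable (by fun_prop)).sub stronglyMeasurable_const).enorm
  have hconv : (ψ ⋆[lsmul ℝ ℝ, μ] f) y - f y = ∫ z, ψ z • (f (y - z) - f y) ∂μ := by
    have hint : Integrable (fun z => ψ z • f (y - z)) μ :=
      hψc.convolutionExists_left (lsmul ℝ ℝ) hψ hfloc y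
    simp_rw [smul_sub]
    rw [integral_sub hint (hψi.smul_const _), integral_smul_const, hψ1, one_smul]
    rfl
  calc ‖(ψ ⋆[lsmul ℝ ℝ, μ] f) y - f y‖ₑ ^ p
      ≤ (∫⁻ z, ENNReal.ofReal (ψ z) * ‖f (y - z) - f y‖ₑ ∂μ) ^ p := by
        rw [hconv]
        gcongr
        refine (enorm_integral_le_lintegral_enorm _).trans (le_of_eq ?_)
        simp only [enorm_smul, Real.enorm_of_nonneg (hψ0 _)]
    _ = (∫⁻ z, ‖f (y - z) - f y‖ₑ ∂μ.withDensity fun z => ENNReal.ofReal (ψ z)) ^ p := by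
        rw [lintegral_withDensity_eq_lintegral_mul _ hw hsub]
        rfl
    _ ≤ ∫⁻ z, ‖f (y - z) - f y‖ₑ ^ p ∂μ.withDensity fun z => ENNReal.ofReal (ψ z) :=
        lintegral_rpow_le_of_isProbabilityMeasure hp hsub.aemeasurable
    _ = ∫⁻ z, ENNReal.ofReal (ψ z) * ‖f (y - z) - f y‖ₑ ^ p ∂μ := by
        rw [lintegral_withDensity_eq_lintegral_mul _ hw (hsub.pow_const _)]
        rfl

theorem eLpNorm_convolution_sub_le [hs1 : Fact (1 ≤ s)] (hs : s ≠ ⊤) (hf : MemLp f s μ)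
    (hfm : StronglyMeasurable f) (hψ : Continuous ψ) (hψc : HasCompactSupport ψ)
    (hψ0 : ∀ z, 0 ≤ ψ z) (hψ1 : ∫ z, ψ z ∂μ = 1) {ε : ℝ≥0∞}
    (h : ∀ z ∈ Function.support ψ, eLpNorm (fun y => f (y - z) - f y) s μ ≤ ε) :
    eLpNorm (fun y => (ψ ⋆[lsmul ℝ ℝ, μ] f) y - f y) s μ ≤ ε := by
  have hs0 : s ≠ 0 := (one_pos.trans_le hs1.out).ne'
  have hp : 1 ≤ s.toReal := by simpa using ENNReal.toReal_mono hs hs1.out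
  have hp0 : 0 < s.toReal := one_pos.trans_le hp
  have hw : Measurable fun z => ENNReal.ofReal (ψ z) := hψ.measurable.ennreal_ofReal
  have hmeas : Measurable fun q : F × F =>
      ENNReal.ofReal (ψ q.2) * ‖f (q.1 - q.2) - f q.1‖ₑ ^ s.toReal :=
    (hw.comp measurable_snd).mul ((((hfm.comp_measurable (by fun_prop)).sub
      (hfm.comp_measurable measurable_fst)).enorm).pow_const _)
  rw [← ENNReal.rpow_le_rpow_iff hp0, eLpNorm_rpow_toReal_eq_energy hs0 hs]
  calc ∫⁻ y, ‖(ψ ⋆[lsmul ℝ ℝ, μ] f) y - f y‖ₑ ^ s.toReal ∂μ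
      ≤ ∫⁻ y, ∫⁻ z, ENNReal.ofReal (ψ z) * ‖f (y - z) - f y‖ₑ ^ s.toReal ∂μ ∂μ :=
        lintegral_mono fun y => enorm_convolution_sub_rpow_le hp hfm
          (hf.locallyIntegrable hs1.out) hψ hψc hψ0 hψ1 y
    _ = ∫⁻ z, ∫⁻ y, ENNReal.ofReal (ψ z) * ‖f (y - z) - f y‖ₑ ^ s.toReal ∂μ ∂μ :=
        lintegral_lintegral_swap hmeas.aemeasurable
    _ ≤ ∫⁻ z, ENNReal.ofReal (ψ z) * ε ^ s.toReal ∂μ := by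
        refine lintegral_mono fun z => ?_
        rw [lintegral_const_mul' _ _ ENNReal.ofReal_ne_top]
        by_cases hz : z ∈ Function.support ψ
        · gcongr
          exact (eLpNorm_rpow_toReal_eq_energy hs0 hs _).symm.trans_le
            (ENNReal.rpow_le_rpow (h z hz) hp0.le)
        · simp [Function.notMem_support.1 hz]
    _ = ε ^ s.toReal := by
        rw [lintegral_mul_const _ hw, ← ofReal_integral_eq_lintegral_ofReal
          (hψ.integrable_of_hasCompactSupport hψc) (.of_forall hψ0), hψ1, ENNReal.ofReal_one,
          one_mul]

theorem tendsto_eLpNorm_convolution_sub [hs1 : Fact (1 ≤ s)] (hs : s ≠ ⊤) (hf : MemLp f s μ)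
    (hfm : StronglyMeasurable f) {ι : Type*} {l : Filter ι} {ψ : ι → F → ℝ}
    (hψ : ∀ i, Continuous (ψ i)) (hψc : ∀ i, HasCompactSupport (ψ i)) (hψ0 : ∀ i z, 0 ≤ ψ i z)
    (hψ1 : ∀ i, ∫ z, ψ i z ∂μ = 1)
    (hsupp : Tendsto (fun i => Function.support (ψ i)) l (𝓝 0).smallSets) :
    Tendsto (fun i => eLpNorm (fun y => (ψ i ⋆[lsmul ℝ ℝ, μ] f) y - f y) s μ) l (𝓝 0) := by
  rw [ENNReal.tendsto_nhds_zero]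
  intro ε hε
  have htrans := ENNReal.tendsto_nhds_zero.1 (tendsto_eLpNorm_translate_sub hs hf) ε hε
  filter_upwards [tendsto_smallSets_iff.1 hsupp _ htrans] with i hi
  exact eLpNorm_convolution_sub_le hs hf hfm (hψ i) (hψc i) (hψ0 i) (hψ1 i) hi

end Density

end Mollification

section WeakGradient

open scoped Convolution
open ContinuousLinearMap (lsmul)

variable {d : ℕ}

theorem continuous_gradient {η : E d → ℝ} (hη : ContDiff ℝ 1 η) : Continuous (gradient η) :=
  (InnerProductSpace.toDual ℝ (E d)).symm.continuous.comp (hη.continuous_fderiv (by simp))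

theorem hasCompactSupport_gradient {η : E d → ℝ} (hη : HasCompactSupport η) :
    HasCompactSupport (gradient η) :=
  (hη.fderiv ℝ).comp_left (g := (InnerProductSpace.toDual ℝ (E d)).symm) (by simp)

theorem gradient_comp_sub_left {η : E d → ℝ} {x y : E d} (hη : DifferentiableAt ℝ η (y - x)) :
    gradient (fun x => η (y - x)) x = -gradient η (y - x) := by
  have h : HasFDerivAt (fun x => η (y - x)) ((fderiv ℝ η (y - x)).comp (-.id ℝ (E d))) x :=
    hη.hasFDerivAt.comp x ((hasFDerivAt_id x).const_sub y)
  rw [gradient, gradient, h.fderiv, ContinuousLinearMap.comp_neg, ContinuousLinearMap.comp_id,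
    map_neg]

theorem tsupport_comp_sub_left (ψ : E d → ℝ) (y : E d) :
    tsupport (fun x => ψ (y - x)) = (fun x => y - x) ⁻¹' tsupport ψ :=
  tsupport_comp_eq_preimage ψ (Homeomorph.subLeft y)

/-- The reflected kernel `x ↦ ψ (y - x)` is an admissible test function. -/
theorem gradient_convolution_eq {Ω : Set (E d)} (hΩ : MeasurableSet Ω) {f : E d → ℝ}
    {G : E d → E d} (hG : IsWeakGradient Ω f G) (hf : LocallyIntegrable (Ω.indicator f) volume)
    {ψ : E d → ℝ} (hψ : ContDiff ℝ ∞ ψ) (hψc : HasCompactSupport ψ) {y : E d}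
    (hy : ∀ z ∈ tsupport ψ, y - z ∈ Ω) :
    gradient (ψ ⋆[lsmul ℝ ℝ, volume] Ω.indicator f) y =
      (ψ ⋆[lsmul ℝ ℝ, volume] Ω.indicator G) y := by
  have hψ1 : ContDiff ℝ 1 ψ := hψ.of_le (by exact_mod_cast le_top)
  have hκ : ContDiff ℝ ∞ fun x => ψ (y - x) := by fun_prop
  have hκc : HasCompactSupport fun x => ψ (y - x) :=
    hψc.comp_homeomorph (Homeomorph.subLeft y)
  have hκΩ : tsupport (fun x => ψ (y - x)) ⊆ Ω := by
    rw [tsupport_comp_sub_left]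
    exact fun x hx => by simpa using hy _ hx
  have htest : ∫ x, Ω.indicator f x • gradient (fun x => ψ (y - x)) x =
      -(ψ ⋆[lsmul ℝ ℝ, volume] Ω.indicator G) y := by
    rw [convolution_lsmul_swap]
    simp only [← indicator_smul_left, ← indicator_smul, integral_indicator hΩ]
    exact hG _ hκ hκc hκΩ
  have hint : Integrable fun x => Ω.indicator f x • gradient (fun x => ψ (y - x)) x :=
    hf.integrable_smul_right_of_hasCompactSupport
      (continuous_gradient (hκ.of_le (by exact_mod_cast le_top))) (hasCompactSupport_gradient hκc)
  have hconv := (hψc.fderiv ℝ).convolutionExists_left ((lsmul ℝ ℝ).precompL (E d))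
    (hψ1.continuous_fderiv (by simp)) hf y
  refine ext_inner_left ℝ fun v => ?_
  rw [inner_gradient_right, (hψc.hasFDerivAt_convolution_left (lsmul ℝ ℝ) hψ1 hf y).fderiv,
    convolution_eq_swap, ← neg_inj, ← inner_neg_right, ← htest, ← integral_inner hint,
    conj_trivial, ContinuousLinearMap.integral_apply hconv.integrable_swap, ← integral_neg]
  congr with x
  simp [gradient_comp_sub_left (hψ1.differentiable (by simp)).differentiableAt, inner_smul_right,
    mul_comm]

end WeakGradient

section Density

open scoped Convolution Manifold
open Metric (ball closedBall)
open ContinuousLinearMap (lsmul)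

variable {d : ℕ} {Ω : Set (E d)}

/-- Arbitrarily small balls of shifts move `N ∩ Ω` into `Ω`; this leaves room for mollifying at
points of `N ∩ Ω` with a kernel supported in such a ball. -/
def InwardShiftable (Ω N : Set (E d)) : Prop :=
  ∀ ρ > 0, ∃ (c : E d) (δ : ℝ), 0 < δ ∧ closedBall c δ ⊆ ball 0 ρ ∧
    ∀ y ∈ N ∩ Ω, ∀ z ∈ closedBall c δ, y - z ∈ Ω

theorem exists_inwardShiftable_ball_of_mem (hΩ : IsOpen Ω) {x : E d} (hx : x ∈ Ω) :
    ∃ R > 0, InwardShiftable Ω (ball x R) := by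
  obtain ⟨R, hR, hRΩ⟩ := Metric.isOpen_iff.1 hΩ x hx
  refine ⟨R / 2, half_pos hR, fun ρ hρ => ⟨0, min ρ R / 2, by positivity, ?_, ?_⟩⟩
  · exact Metric.closedBall_subset_ball (by linarith [min_le_left ρ R])
  · rintro y ⟨hy, -⟩ z hz
    rw [mem_ball_iff_norm] at hy
    rw [mem_closedBall_zero_iff] at hz
    refine hRΩ (mem_ball_iff_norm.2 ?_)
    calc ‖y - z - x‖ ≤ ‖y - x‖ + ‖z‖ := by rw [sub_right_comm]; exact norm_sub_le _ _
      _ < R := by linarith [min_le_right ρ R]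

theorem exists_inwardShiftable_ball_of_mem_frontier (hlip : HasLipschitzBoundary Ω) {x : E d}
    (hx : x ∈ frontier Ω) : ∃ R > 0, InwardShiftable Ω (ball x R) := by
  obtain ⟨c⟩ := hlip.nonempty_boundaryChart hx
  refine ⟨c.radius / 2, c.half_radius_pos, fun ρ hρ => ?_⟩
  have hm : 0 < min ρ (c.radius / 2) := lt_min hρ c.half_radius_pos
  obtain ⟨δ, hδ, hδm⟩ : ∃ δ > 0, (c.lip + 3) * δ < min ρ (c.radius / 2) :=
    ⟨min ρ (c.radius / 2) / (2 * (c.lip + 3)), by positivity, by field_simp; linarith⟩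
  refine ⟨-((c.lip + 2) * δ) • c.axis, δ, hδ, Metric.closedBall_subset_ball' ?_, ?_⟩
  · rw [dist_zero_right, norm_smul, c.norm_axis, norm_neg, Real.norm_of_nonneg (by positivity)]
    linarith [min_le_left ρ (c.radius / 2)]
  · rintro y ⟨hy, hyΩ⟩ z hz
    refine c.closedBall_add_smul_subset (t := (c.lip + 2) * δ) hy (subset_closure hyΩ)
      (by linarith) (by linarith [min_le_right ρ (c.radius / 2)]) ?_
    rw [mem_closedBall_iff_norm] at hz ⊢
    rw [neg_smul, sub_neg_eq_add, ← norm_neg] at hz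
    convert hz using 1
    exact congrArg _ (by abel)

theorem exists_inwardShiftable_ball (hΩ : IsOpen Ω) (hlip : HasLipschitzBoundary Ω) {x : E d}
    (hx : x ∈ closure Ω) : ∃ R > 0, InwardShiftable Ω (ball x R) := by
  by_cases hxΩ : x ∈ Ω
  · exact exists_inwardShiftable_ball_of_mem hΩ hxΩ
  · exact exists_inwardShiftable_ball_of_mem_frontier hlip (hΩ.frontier_eq ▸ ⟨hx, hxΩ⟩)

variable {s : ℝ≥0∞} {f : E d → ℝ} {G : E d → E d}

/-- `f` and `G` are the limits in `L^s(μ)` of smooth functions and of their gradients. -/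
def IsSmoothlyApproximable (s : ℝ≥0∞) (μ : Measure (E d)) (f : E d → ℝ) (G : E d → E d) : Prop :=
  ∃ η : ℕ → E d → ℝ, (∀ n, ContDiff ℝ ∞ (η n)) ∧
    Tendsto (fun n => eLpNorm (fun x => η n x - f x) s μ) atTop (𝓝 0) ∧
    Tendsto (fun n => eLpNorm (fun x => gradient (η n) x - G x) s μ) atTop (𝓝 0)

theorem InwardShiftable.exists_mollifiers {N : Set (E d)} (hN : InwardShiftable Ω N) :
    ∃ ψ : ℕ → E d → ℝ, (∀ n, ContDiff ℝ ∞ (ψ n) ∧ HasCompactSupport (ψ n) ∧ (∀ z, 0 ≤ ψ n z) ∧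
      ∫ z, ψ n z = 1) ∧ Tendsto (fun n => Function.support (ψ n)) atTop (𝓝 0).smallSets ∧
      ∀ n, ∀ y ∈ N ∩ Ω, ∀ z ∈ tsupport (ψ n), y - z ∈ Ω := by
  choose c δ hδ hcδ hshift using fun n : ℕ => hN (1 / (n + 1)) Nat.one_div_pos_of_nat
  let φ (n : ℕ) : ContDiffBump (c n) := ⟨δ n / 2, δ n, half_pos (hδ n), half_lt_self (hδ n)⟩
  have hsupp (n : ℕ) : tsupport ((φ n).normed volume) = closedBall (c n) (δ n) :=
    (φ n).tsupport_normed_eq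
  refine ⟨fun n => (φ n).normed volume, fun n => ⟨(φ n).contDiff_normed,
    (φ n).hasCompactSupport_normed, (φ n).nonneg_normed, (φ n).integral_normed⟩, ?_,
    fun n y hy z hz => hshift n y hy z (hsupp n ▸ hz)⟩
  rw [tendsto_smallSets_iff]
  intro t ht
  obtain ⟨ρ, hρ, hρt⟩ := Metric.mem_nhds_iff.1 ht
  filter_upwards [tendsto_one_div_add_atTop_nhds_zero_nat.eventually_lt_const hρ] with n hn
  exact (subset_tsupport _).trans <| (hsupp n).trans_subset <|
    (hcδ n).trans <| (Metric.ball_subset_ball hn.le).trans hρt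

theorem InwardShiftable.isSmoothlyApproximable [hs1 : Fact (1 ≤ s)] (hs : s ≠ ⊤)
    (hΩ : MeasurableSet Ω) {N : Set (E d)} (hNm : MeasurableSet N) (hN : InwardShiftable Ω N)
    (hG : IsWeakGradient Ω f G) (hf : MemLp f s (vol Ω)) (hfm : StronglyMeasurable f)
    (hGL : MemLp G s (vol Ω)) (hGm : StronglyMeasurable G) :
    IsSmoothlyApproximable s ((vol Ω).restrict N) f G := by
  obtain ⟨ψ, hψ, hsupp, hshift⟩ := hN.exists_mollifiers
  choose hψs hψc hψ0 hψ1 using hψ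
  have hf0 : MemLp (Ω.indicator f) s volume := (memLp_indicator_iff_restrict hΩ).2 hf
  have hG0 : MemLp (Ω.indicator G) s volume := (memLp_indicator_iff_restrict hΩ).2 hGL
  have hloc := hf0.locallyIntegrable hs1.out
  have hle {X : Type} [NormedAddCommGroup X] {u v : E d → X} (h : EqOn u v (N ∩ Ω)) :
      eLpNorm u s ((vol Ω).restrict N) ≤ eLpNorm v s volume := by
    rw [Measure.restrict_restrict hNm]
    refine le_of_eq_of_le (eLpNorm_congr_ae ?_) (eLpNorm_restrict_le _ _ _ _)
    filter_upwards [ae_restrict_mem (hNm.inter hΩ)] with y hy using h hy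
  refine ⟨fun n => ψ n ⋆[lsmul ℝ ℝ, volume] Ω.indicator f,
    fun n => (hψc n).contDiff_convolution_left _ (hψs n) hloc, ?_, ?_⟩
  · refine tendsto_nhds_bot_mono' (tendsto_eLpNorm_convolution_sub hs hf0 (hfm.indicator hΩ)
      (fun n => (hψs n).continuous) hψc hψ0 hψ1 hsupp) fun n => hle fun y hy => ?_
    simp only [indicator_of_mem hy.2]
  · refine tendsto_nhds_bot_mono' (tendsto_eLpNorm_convolution_sub hs hG0 (hGm.indicator hΩ)
      (fun n => (hψs n).continuous) hψc hψ0 hψ1 hsupp) fun n => hle fun y hy => ?_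
    have hgrad := gradient_convolution_eq hΩ hG hloc (hψs n) (hψc n) (hshift n y hy)
    simp only [hgrad, indicator_of_mem hy.2]

theorem tendsto_eLpNorm_zero_of_norm_le_mul {W X Y : Type*} [NormedAddCommGroup W]
    [NormedAddCommGroup X] [NormedAddCommGroup Y] {μ : Measure (E d)} {N : Set (E d)}
    {b : E d → W} {g : ℕ → E d → X} {u : ℕ → E d → Y} (hb : Continuous b)
    (hbc : HasCompactSupport b) (hbN : tsupport b ⊆ N) (h : ∀ n x, ‖g n x‖ ≤ ‖b x‖ * ‖u n x‖)
    (hu : Tendsto (fun n => eLpNorm (u n) s (μ.restrict N)) atTop (𝓝 0)) :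
    Tendsto (fun n => eLpNorm (g n) s μ) atTop (𝓝 0) := by
  obtain ⟨M, hM⟩ := hbc.exists_bound_of_continuous hb
  have hMu : Tendsto (fun n => ENNReal.ofReal M * eLpNorm (u n) s (μ.restrict N)) atTop (𝓝 0) := by
    simpa using ENNReal.Tendsto.const_mul hu (.inr ENNReal.ofReal_ne_top)
  refine tendsto_nhds_bot_mono' hMu fun n => ?_
  have hind : (tsupport b).indicator (g n) = g n := indicator_eq_self.2 fun x hx => by
    by_contra hxb
    exact hx (norm_le_zero_iff.1
      (by simpa [image_eq_zero_of_notMem_tsupport hxb] using h n x))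
  rw [← hind, eLpNorm_indicator_eq_eLpNorm_restrict (isClosed_tsupport b).measurableSet]
  refine (eLpNorm_le_mul_eLpNorm_of_ae_le_mul (.of_forall fun x => (h n x).trans ?_) s).trans
    (mul_le_mul_right (eLpNorm_mono_measure _ (Measure.restrict_mono_set μ hbN)) _)
  gcongr
  exact hM x

theorem tendsto_eLpNorm_sum_zero [hs1 : Fact (1 ≤ s)] {α X ι : Type*} [MeasurableSpace α]
    {μ : Measure α} [NormedAddCommGroup X] {t : Finset ι} {g : ι → ℕ → α → X}
    (hg : ∀ i ∈ t, ∀ n, AEStronglyMeasurable (g i n) μ)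
    (h : ∀ i ∈ t, Tendsto (fun n => eLpNorm (g i n) s μ) atTop (𝓝 0)) :
    Tendsto (fun n => eLpNorm (∑ i ∈ t, g i n) s μ) atTop (𝓝 0) := by
  have hsum := tendsto_finsetSum t h
  rw [Finset.sum_const_zero] at hsum
  exact tendsto_nhds_bot_mono' hsum fun n => eLpNorm_sum_le (fun i hi => hg i hi n) hs1.out

theorem exists_finite_smooth_partition {K : Set (E d)} (hK : IsCompact K) {N : E d → Set (E d)}
    (hN : ∀ x ∈ K, N x ∈ 𝓝 x) :
    ∃ (t : Finset (E d)) (a : t → E d → ℝ), (↑t ⊆ K) ∧ (∀ y ∈ K, ∑ i, a i y = 1) ∧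
      ∀ i, ContDiff ℝ ∞ (a i) ∧ HasCompactSupport (a i) ∧ tsupport (a i) ⊆ N i := by
  let U (x : E d) : Set (E d) := interior (N x) ∩ ball x 1
  have hU (x : E d) (hx : x ∈ K) : U x ∈ 𝓝 x :=
    inter_mem (interior_mem_nhds.2 (hN x hx)) (Metric.ball_mem_nhds x one_pos)
  obtain ⟨t, htK, ht⟩ := hK.elim_nhds_subcover U hU
  have hcover : K ⊆ ⋃ i : t, U i := by rwa [iUnion_subtype]
  obtain ⟨a, ha⟩ := SmoothPartitionOfUnity.exists_isSubordinate 𝓘(ℝ, E d) hK.isClosed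
    (fun i : t => U i) (fun i => isOpen_interior.inter Metric.isOpen_ball) hcover
  refine ⟨t, fun i => a i, htK, fun y hy => ?_, fun i => ⟨(a i).contMDiff.contDiff, ?_,
    (ha i).trans (inter_subset_left.trans interior_subset)⟩⟩
  · rw [← a.sum_eq_one hy, finsum_eq_sum_of_fintype]
  · exact Metric.isCompact_of_isClosed_isBounded (isClosed_tsupport _)
      (Metric.isBounded_ball.subset ((ha i).trans inter_subset_right))

theorem gradient_mul {a b : E d → ℝ} {x : E d} (ha : DifferentiableAt ℝ a x)
    (hb : DifferentiableAt ℝ b x) :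
    gradient (fun x => a x * b x) x = a x • gradient b x + b x • gradient a x := by
  simp only [gradient, fderiv_fun_mul ha hb, map_add, map_smul]

theorem gradient_sum {ι : Type*} {t : Finset ι} {a : ι → E d → ℝ} {x : E d}
    (ha : ∀ i ∈ t, DifferentiableAt ℝ (a i) x) :
    gradient (fun x => ∑ i ∈ t, a i x) x = ∑ i ∈ t, gradient (a i) x := by
  simp only [gradient, fderiv_fun_sum ha, map_sum]

theorem IsSmoothlyApproximable.congr_ae {μ : Measure (E d)} {f' : E d → ℝ} {G' : E d → E d}
    (h : IsSmoothlyApproximable s μ f G) (hf : f =ᵐ[μ] f') (hG : G =ᵐ[μ] G') :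
    IsSmoothlyApproximable s μ f' G' := by
  obtain ⟨η, hη, hηf, hηG⟩ := h
  refine ⟨η, hη, hηf.congr fun n => eLpNorm_congr_ae ?_, hηG.congr fun n => eLpNorm_congr_ae ?_⟩
  · filter_upwards [hf] with x hx using by rw [hx]
  · filter_upwards [hG] with x hx using by rw [hx]

theorem IsSmoothlyApproximable.cutoff_mul [hs1 : Fact (1 ≤ s)] {μ : Measure (E d)} {N : Set (E d)}
    {a : E d → ℝ} (h : IsSmoothlyApproximable s (μ.restrict N) f G) (ha : ContDiff ℝ ∞ a)
    (hac : HasCompactSupport a) (haN : tsupport a ⊆ N) (hf : AEStronglyMeasurable f μ)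
    (hG : AEStronglyMeasurable G μ) :
    IsSmoothlyApproximable s μ (fun x => a x * f x) fun x => a x • G x + f x • gradient a x := by
  obtain ⟨η, hη, hηf, hηG⟩ := h
  have ha1 : ContDiff ℝ 1 a := ha.of_le (by exact_mod_cast le_top)
  have hη1 (n) : ContDiff ℝ 1 (η n) := (hη n).of_le (by exact_mod_cast le_top)
  have hga := continuous_gradient ha1
  have hgaN : tsupport (gradient a) ⊆ N :=
    (tsupport_comp_subset (g := (InnerProductSpace.toDual ℝ (E d)).symm) (map_zero _) _).trans
      ((tsupport_fderiv_subset ℝ).trans haN)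
  have haf : Tendsto (fun n => eLpNorm (fun x => a x * (η n x - f x)) s μ) atTop (𝓝 0) :=
    tendsto_eLpNorm_zero_of_norm_le_mul ha.continuous hac haN (fun n x => norm_mul_le _ _) hηf
  have haG : Tendsto (fun n => eLpNorm (fun x => a x • (gradient (η n) x - G x)) s μ) atTop
      (𝓝 0) :=
    tendsto_eLpNorm_zero_of_norm_le_mul ha.continuous hac haN (fun n x => norm_smul_le _ _) hηG
  have hfga : Tendsto (fun n => eLpNorm (fun x => (η n x - f x) • gradient a x) s μ) atTop
      (𝓝 0) :=
    tendsto_eLpNorm_zero_of_norm_le_mul hga (hasCompactSupport_gradient hac) hgaN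
      (fun n x => (norm_smul_le _ _).trans_eq (mul_comm _ _)) hηf
  refine ⟨fun n x => a x * η n x, fun n => ha.mul (hη n), by simpa only [mul_sub] using haf, ?_⟩
  refine tendsto_nhds_bot_mono' (by simpa using haG.add hfga) fun n => ?_
  refine le_of_eq_of_le (congrArg (eLpNorm · s μ) ?_) (eLpNorm_add_le
    (ha.continuous.aestronglyMeasurable.smul
      ((continuous_gradient (hη1 n)).aestronglyMeasurable.sub hG))
    (((hη n).continuous.aestronglyMeasurable.sub hf).smul hga.aestronglyMeasurable) hs1.out)
  ext1 x
  rw [gradient_mul (ha1.differentiable one_ne_zero x) ((hη1 n).differentiable one_ne_zero x),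
    Pi.add_apply]
  module

theorem IsSmoothlyApproximable.sum [hs1 : Fact (1 ≤ s)] {μ : Measure (E d)} {ι : Type*}
    {t : Finset ι} {f : ι → E d → ℝ} {G : ι → E d → E d}
    (h : ∀ i ∈ t, IsSmoothlyApproximable s μ (f i) (G i))
    (hf : ∀ i ∈ t, AEStronglyMeasurable (f i) μ) (hG : ∀ i ∈ t, AEStronglyMeasurable (G i) μ) :
    IsSmoothlyApproximable s μ (fun x => ∑ i ∈ t, f i x) fun x => ∑ i ∈ t, G i x := by
  choose! η hη hηf hηG using h
  have hη1 (i) (hi : i ∈ t) (n) : ContDiff ℝ 1 (η i n) :=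
    (hη i hi n).of_le (by exact_mod_cast le_top)
  refine ⟨fun n x => ∑ i ∈ t, η i n x, fun n => ContDiff.sum fun i hi => hη i hi n,
    (tendsto_eLpNorm_sum_zero (fun i hi n =>
      (hη i hi n).continuous.aestronglyMeasurable.sub (hf i hi)) hηf).congr fun n => ?_,
    (tendsto_eLpNorm_sum_zero (fun i hi n =>
      (continuous_gradient (hη1 i hi n)).aestronglyMeasurable.sub (hG i hi)) hηG).congr fun n => ?_⟩
  · congr 1
    ext1 x
    simp only [Finset.sum_apply, Pi.sub_apply, Finset.sum_sub_distrib]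
  · congr 1
    ext1 x
    rw [gradient_sum fun i hi => (hη1 i hi n).differentiable one_ne_zero x]
    simp only [Finset.sum_apply, Pi.sub_apply, Finset.sum_sub_distrib]

theorem isSmoothlyApproximable_of_locally [Fact (1 ≤ s)] {K : Set (E d)} (hK : IsCompact K)
    (hΩ : IsOpen Ω) (hΩK : Ω ⊆ K) (hf : AEStronglyMeasurable f (vol Ω))
    (hG : AEStronglyMeasurable G (vol Ω))
    (h : ∀ x ∈ K, ∃ N ∈ 𝓝 x, IsSmoothlyApproximable s ((vol Ω).restrict N) f G) :
    IsSmoothlyApproximable s (vol Ω) f G := by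
  choose! N hN happrox using h
  obtain ⟨t, a, htK, hsum, ha⟩ := exists_finite_smooth_partition hK hN
  choose ha hac haN using ha
  have ha1 (i) : ContDiff ℝ 1 (a i) := (ha i).of_le (by exact_mod_cast le_top)
  have hgsum (x) (hx : x ∈ Ω) : ∑ i, gradient (a i) x = 0 := by
    have hone : (fun x => ∑ i, a i x) =ᶠ[𝓝 x] fun _ => 1 := by
      filter_upwards [hΩ.mem_nhds hx] with y hy using hsum y (hΩK hy)
    rw [← gradient_sum fun i _ => (ha1 i).differentiable one_ne_zero x, hone.gradient_eq,
      gradient_fun_const]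
  refine (IsSmoothlyApproximable.sum (t := Finset.univ)
    (fun (i : t) _ => (happrox i (htK i.2)).cutoff_mul (ha i) (hac i) (haN i) hf hG)
    (fun i _ => (ha i).continuous.aestronglyMeasurable.mul hf)
    (fun i _ => ((ha i).continuous.aestronglyMeasurable.smul hG).add
      (hf.smul (continuous_gradient (ha1 i)).aestronglyMeasurable))).congr_ae ?_ ?_
  · filter_upwards [ae_restrict_mem hΩ.measurableSet] with x hx
    rw [← Finset.sum_mul, hsum x (hΩK hx), one_mul]
  · filter_upwards [ae_restrict_mem hΩ.measurableSet] with x hx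
    rw [Finset.sum_add_distrib, ← Finset.sum_smul, ← Finset.smul_sum, hsum x (hΩK hx), hgsum x hx,
      one_smul, smul_zero, add_zero]

theorem IsBoundedLipschitz.isSmoothlyApproximable (hΩ : IsBoundedLipschitz Ω) [Fact (1 ≤ s)]
    (hs : s ≠ ⊤) (ξ : sobolev Ω s) : IsSmoothlyApproximable s (vol Ω) (fn ξ) (grad ξ) := by
  refine isSmoothlyApproximable_of_locally hΩ.isBounded.isCompact_closure hΩ.isOpen subset_closure
    (Lp.aestronglyMeasurable _) (Lp.aestronglyMeasurable _) fun x hx => ?_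
  obtain ⟨R, hR, hshift⟩ := exists_inwardShiftable_ball hΩ.isOpen hΩ.hasLipschitzBoundary hx
  exact ⟨ball x R, Metric.ball_mem_nhds x hR, hshift.isSmoothlyApproximable hs
    hΩ.isOpen.measurableSet measurableSet_ball ξ.2 (Lp.memLp _) (Lp.stronglyMeasurable _)
    (Lp.memLp _) (Lp.stronglyMeasurable _)⟩

end Density

theorem norm_le_of_enorm_rpow_le {X Y : Type*} [NormedAddCommGroup X] [NormedAddCommGroup Y] {p : ℝ}
    (hp : 0 < p) {C : ℝ≥0∞} (hC : C ≠ ⊤) {x : X} {y : Y}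
    (h : ‖x‖ₑ ^ p ≤ C * ‖y‖ₑ ^ p) : ‖x‖ ≤ (C ^ p⁻¹).toReal * ‖y‖ := by
  have hCp : C ^ p⁻¹ ≠ ⊤ := ENNReal.rpow_ne_top_of_nonneg (by positivity) hC
  have hle : ‖x‖ₑ ≤ C ^ p⁻¹ * ‖y‖ₑ := by
    rwa [← ENNReal.rpow_le_rpow_iff hp, ENNReal.mul_rpow_of_nonneg _ _ hp.le,
      ENNReal.rpow_inv_rpow hp.ne']
  simpa using ENNReal.toReal_mono (by finiteness) hle

section NormedSpace

variable {X Y Z : Type*} [NormedAddCommGroup X] [NormedSpace ℝ X] [NormedAddCommGroup Y]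
  [NormedSpace ℝ Y] [NormedAddCommGroup Z] [NormedSpace ℝ Z] {W : Submodule ℝ X}

theorem norm_le_mul_norm_of_mem_closure (A : X →L[ℝ] Y) (B : X →L[ℝ] Z) {K : ℝ}
    (h : ∀ x ∈ W, ‖A x‖ ≤ K * ‖B x‖) : ∀ x ∈ W.topologicalClosure, ‖A x‖ ≤ K * ‖B x‖ :=
  fun _ hx => closure_minimal h (isClosed_le A.continuous.norm (B.continuous.norm.const_mul K)) hx

theorem isClosed_image_of_norm_le_mul [CompleteSpace X] (hW : IsClosed (W : Set X)) (B : X →L[ℝ] Y)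
    {K : ℝ≥0} (h : ∀ x ∈ W, ‖x‖ ≤ K * ‖B x‖) : IsClosed (B '' W) := by
  have : CompleteSpace W := hW.completeSpace_coe
  have hanti : AntilipschitzWith K (B ∘L W.subtypeL) :=
    ContinuousLinearMap.antilipschitz_of_bound _ fun x => h x x.2
  have hclosed := hanti.isClosed_range (B ∘L W.subtypeL).uniformContinuous
  rwa [ContinuousLinearMap.coe_comp, range_comp, Submodule.coe_subtypeL, Submodule.coe_subtype,
    Subtype.range_coe] at hclosed

theorem exists_norm_le_mul_of_sub_smul_le {e : X} (B : X →L[ℝ] Y) (N : X →L[ℝ] Z) (hN : N e ≠ 0)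
    {K : ℝ} (hK : 0 ≤ K) (h : ∀ x ∈ W, ∃ c : ℝ, ‖x - c • e‖ ≤ K * ‖B x‖) :
    ∃ K' : ℝ≥0, ∀ x ∈ W, ‖x‖ ≤ K' * ‖(B.prod N) x‖ := by
  have hNe : 0 < ‖N e‖ := norm_pos_iff.2 hN
  refine ⟨⟨K + (1 + ‖N‖ * K) / ‖N e‖ * ‖e‖, by positivity⟩, fun x hx => ?_⟩
  obtain ⟨c, hc⟩ := h x hx
  have hsub : ‖x - c • e‖ ≤ K * ‖(B.prod N) x‖ :=
    hc.trans (mul_le_mul_of_nonneg_left (norm_fst_le (B.prod N x)) hK)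
  have hcN : |c| * ‖N e‖ ≤ (1 + ‖N‖ * K) * ‖(B.prod N) x‖ := calc
    |c| * ‖N e‖ = ‖N x - N (x - c • e)‖ := by simp [norm_smul]
    _ ≤ ‖N x‖ + ‖N‖ * ‖x - c • e‖ := (norm_sub_le _ _).trans (add_le_add_right (N.le_opNorm _) _)
    _ ≤ ‖(B.prod N) x‖ + ‖N‖ * (K * ‖(B.prod N) x‖) :=
      add_le_add (norm_snd_le (B.prod N x)) (mul_le_mul_of_nonneg_left hsub (norm_nonneg _))
    _ = (1 + ‖N‖ * K) * ‖(B.prod N) x‖ := by ring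
  calc ‖x‖ = ‖(x - c • e) + c • e‖ := by rw [sub_add_cancel]
    _ ≤ ‖x - c • e‖ + |c| * ‖e‖ := (norm_add_le _ _).trans_eq (by rw [norm_smul, Real.norm_eq_abs])
    _ ≤ K * ‖(B.prod N) x‖ + (1 + ‖N‖ * K) * ‖(B.prod N) x‖ / ‖N e‖ * ‖e‖ :=
      add_le_add hsub (mul_le_mul_of_nonneg_right ((le_div_iff₀ hNe).2 hcN) (norm_nonneg _))
    _ = (K + (1 + ‖N‖ * K) / ‖N e‖ * ‖e‖) * ‖(B.prod N) x‖ := by ring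

end NormedSpace

section Trace

variable {d : ℕ} {Ω : Set (E d)} {s : ℝ≥0∞}

theorem IsBoundedLipschitz.isFiniteMeasure_vol (hΩ : IsBoundedLipschitz Ω) :
    IsFiniteMeasure (vol Ω) :=
  ⟨by simpa using hΩ.isBounded.measure_lt_top⟩

theorem IsBoundedLipschitz.isFiniteMeasure_surf (hΩ : IsBoundedLipschitz Ω) :
    IsFiniteMeasure (surf Ω) :=
  ⟨hΩ.surf_univ_lt_top⟩

theorem memLp_restrict_of_isBounded {X : Type*} [NormedAddCommGroup X] {μ : Measure (E d)}
    {S : Set (E d)} [IsFiniteMeasure (μ.restrict S)] (hS : Bornology.IsBounded S)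
    (hSm : MeasurableSet S) {f : E d → X} (hf : Continuous f) : MemLp f s (μ.restrict S) := by
  obtain ⟨M, hM⟩ := hS.isCompact_closure.exists_bound_of_continuousOn hf.continuousOn
  refine MemLp.of_bound hf.aestronglyMeasurable M ?_
  filter_upwards [ae_restrict_mem hSm] with x hx using hM x (subset_closure hx)

/-- A function, its gradient and its boundary values, as elements of the `L^s` spaces in which the
convergence defining `IsTrace` takes place. -/
abbrev Triple (Ω : Set (E d)) (s : ℝ≥0∞) :=
  Lp ℝ s (vol Ω) × Lp (E d) s (vol Ω) × Lp ℝ s (surf Ω)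

/-- The triple `x` consists of the classes of `η`, of `∇η` and of the boundary values of `η`. -/
def IsTripleOf (η : E d → ℝ) (x : Triple Ω s) : Prop :=
  x.1 =ᵐ[vol Ω] η ∧ x.2.1 =ᵐ[vol Ω] gradient η ∧ x.2.2 =ᵐ[surf Ω] η

theorem IsTripleOf.add {η ζ : E d → ℝ} {x y : Triple Ω s} (hη : Differentiable ℝ η)
    (hζ : Differentiable ℝ ζ) (hx : IsTripleOf η x) (hy : IsTripleOf ζ y) :
    IsTripleOf (η + ζ) (x + y) := by
  have hgrad : gradient (η + ζ) = gradient η + gradient ζ := by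
    ext1 z
    simp only [gradient, fderiv_add (hη z) (hζ z), map_add, Pi.add_apply]
  exact ⟨(Lp.coeFn_add _ _).trans (hx.1.add hy.1),
    hgrad ▸ (Lp.coeFn_add _ _).trans (hx.2.1.add hy.2.1),
    (Lp.coeFn_add _ _).trans (hx.2.2.add hy.2.2)⟩

theorem IsTripleOf.const_smul {η : E d → ℝ} {x : Triple Ω s} (hη : Differentiable ℝ η)
    (hx : IsTripleOf η x) (c : ℝ) : IsTripleOf (c • η) (c • x) := by
  have hgrad : gradient (c • η) = c • gradient η := by
    ext1 z
    simp only [gradient, fderiv_const_smul (hη z), map_smul, Pi.smul_apply]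
  exact ⟨(Lp.coeFn_smul _ _).trans (hx.1.const_smul c),
    hgrad ▸ (Lp.coeFn_smul _ _).trans (hx.2.1.const_smul c),
    (Lp.coeFn_smul _ _).trans (hx.2.2.const_smul c)⟩

theorem IsBoundedLipschitz.exists_isTripleOf (hΩ : IsBoundedLipschitz Ω) {η : E d → ℝ}
    (hη : ContDiff ℝ 1 η) : ∃ x : Triple Ω s, IsTripleOf η x := by
  have := hΩ.isFiniteMeasure_vol
  have := hΩ.isFiniteMeasure_surf
  have hvol : MemLp η s (vol Ω) :=
    memLp_restrict_of_isBounded hΩ.isBounded hΩ.isOpen.measurableSet hη.continuous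
  have hgrad : MemLp (gradient η) s (vol Ω) :=
    memLp_restrict_of_isBounded hΩ.isBounded hΩ.isOpen.measurableSet (continuous_gradient hη)
  have hsurf : MemLp η s (surf Ω) :=
    memLp_restrict_of_isBounded (hΩ.isBounded.closure.subset frontier_subset_closure)
      isClosed_frontier.measurableSet hη.continuous
  exact ⟨⟨hvol.toLp η, hgrad.toLp _, hsurf.toLp η⟩, hvol.coeFn_toLp, hgrad.coeFn_toLp,
    hsurf.coeFn_toLp⟩

variable (Ω s) in
/-- The triples of smooth functions. By `isTrace_iff` their closure is the set of all triples
`(ξ, ∇ξ, g)` such that `g` is the trace of `ξ`. -/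
def smoothTriples : Submodule ℝ (Triple Ω s) where
  carrier := {x | ∃ η : E d → ℝ, ContDiff ℝ ∞ η ∧ IsTripleOf η x}
  zero_mem' := by
    refine ⟨0, contDiff_const, Lp.coeFn_zero _ _ _, ?_, Lp.coeFn_zero _ _ _⟩
    exact (Lp.coeFn_zero _ _ _).trans (.of_eq (funext fun z => (gradient_fun_const z 0).symm))
  add_mem' := by
    rintro x y ⟨η, hη, hx⟩ ⟨ζ, hζ, hy⟩
    exact ⟨η + ζ, hη.add hζ, hx.add (hη.differentiable (by simp)) (hζ.differentiable (by simp)) hy⟩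
  smul_mem' := by
    rintro c x ⟨η, hη, hx⟩
    exact ⟨c • η, contDiff_const.smul hη, hx.const_smul (hη.differentiable (by simp)) c⟩

variable [hs1 : Fact (1 ≤ s)]

theorem tendsto_Lp_iff_of_coeFn_ae_eq {α X : Type*} [MeasurableSpace α] [NormedAddCommGroup X]
    {μ : Measure α} {u : ℕ → Lp X s μ} {f : ℕ → α → X} (hu : ∀ n, u n =ᵐ[μ] f n) (v : Lp X s μ) :
    Tendsto u atTop (𝓝 v) ↔ Tendsto (fun n => eLpNorm (fun x => f n x - v x) s μ) atTop (𝓝 0) := by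
  rw [Lp.tendsto_Lp_iff_tendsto_eLpNorm']
  exact tendsto_congr fun n => eLpNorm_congr_ae ((hu n).sub .rfl)

theorem tendsto_triple_iff {η : ℕ → E d → ℝ} {x : ℕ → Triple Ω s}
    (hx : ∀ n, IsTripleOf (η n) (x n)) (y : Triple Ω s) : Tendsto x atTop (𝓝 y) ↔
      Tendsto (fun n => eLpNorm (fun z => η n z - y.1 z) s (vol Ω)) atTop (𝓝 0) ∧
      Tendsto (fun n => eLpNorm (fun z => gradient (η n) z - y.2.1 z) s (vol Ω)) atTop (𝓝 0) ∧
      Tendsto (fun n => eLpNorm (fun z => η n z - y.2.2 z) s (surf Ω)) atTop (𝓝 0) := by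
  rw [Prod.tendsto_iff, Prod.tendsto_iff, tendsto_Lp_iff_of_coeFn_ae_eq fun n => (hx n).1,
    tendsto_Lp_iff_of_coeFn_ae_eq fun n => (hx n).2.1,
    tendsto_Lp_iff_of_coeFn_ae_eq fun n => (hx n).2.2]

theorem IsBoundedLipschitz.isTrace_iff (hΩ : IsBoundedLipschitz Ω) {ξ : sobolev Ω s}
    {g : Lp ℝ s (surf Ω)} :
    IsTrace ξ g ↔ (fn ξ, grad ξ, g) ∈ (smoothTriples Ω s).topologicalClosure := by
  rw [← SetLike.mem_coe, Submodule.topologicalClosure_coe, mem_closure_iff_seq_limit]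
  constructor
  · rintro ⟨η, hη, hlim⟩
    choose x hx using fun n =>
      hΩ.exists_isTripleOf (s := s) ((hη n).of_le (by exact_mod_cast le_top))
    exact ⟨x, fun n => ⟨η n, hη n, hx n⟩, (tendsto_triple_iff hx _).2 hlim⟩
  · rintro ⟨x, hx, hlim⟩
    choose η hη hxη using hx
    have hlim' := (tendsto_triple_iff hxη (fn ξ, grad ξ, g)).1 hlim
    exact ⟨η, hη, hlim'⟩

theorem enorm_rpow_eq_energy (hs : s ≠ ⊤) {α X : Type*} [MeasurableSpace α] [NormedAddCommGroup X]
    {μ : Measure α} {u : Lp X s μ} {f : α → X} (hu : u =ᵐ[μ] f) :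
    ‖u‖ₑ ^ s.toReal = energy s.toReal μ f := by
  rw [Lp.enorm_def, eLpNorm_congr_ae hu,
    eLpNorm_rpow_toReal_eq_energy (one_pos.trans_le hs1.out).ne' hs]

theorem energy_gradient (p : ℝ) (μ : Measure (E d)) (η : E d → ℝ) :
    energy p μ (gradient η) = energy p μ (fderiv ℝ η) := by
  simp only [energy, gradient, LinearIsometryEquiv.enorm_map]

end Trace

section Poincare

variable {d : ℕ} {Ω : Set (E d)} {s : ℝ≥0∞} [hs1 : Fact (1 ≤ s)]

variable (Ω s) in
/-- The restriction of a triple to `Ω`, which forgets the boundary values. -/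
noncomputable def interiorPart : Triple Ω s →L[ℝ] Lp ℝ s (vol Ω) × Lp (E d) s (vol Ω) :=
  .prodMap (.id ℝ _) (.fst ℝ _ _)

variable (Ω s) in
/-- The gradient component of a triple. -/
noncomputable def gradientPart : Triple Ω s →L[ℝ] Lp (E d) s (vol Ω) :=
  .fst ℝ _ _ ∘L .snd ℝ _ _

variable (Ω s) in
/-- The boundary component of a triple. -/
noncomputable def boundaryPart : Triple Ω s →L[ℝ] Lp ℝ s (surf Ω) :=
  .snd ℝ _ _ ∘L .snd ℝ _ _

theorem IsBoundedLipschitz.exists_boundaryPart_le (hΩ : IsBoundedLipschitz Ω) (hs : s ≠ ⊤) :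
    ∃ K : ℝ≥0, ∀ x ∈ (smoothTriples Ω s).topologicalClosure,
      ‖boundaryPart Ω s x‖ ≤ K * ‖interiorPart Ω s x‖ := by
  have hp : 1 ≤ s.toReal := ENNReal.toReal_mono hs hs1.out
  obtain ⟨C, hC, hle⟩ := hΩ.gradDominated_surf hp
  refine ⟨((C * 2) ^ s.toReal⁻¹).toNNReal, norm_le_mul_norm_of_mem_closure _ _ ?_⟩
  rintro x ⟨η, hη, hx, hxg, hxb⟩
  refine norm_le_of_enorm_rpow_le (one_pos.trans_le hp) (by finiteness) ?_
  have hfst : ‖x.1‖ₑ ≤ ‖interiorPart Ω s x‖ₑ :=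
    enorm_le_iff_norm_le.2 (norm_fst_le (interiorPart Ω s x))
  have hsnd : ‖x.2.1‖ₑ ≤ ‖interiorPart Ω s x‖ₑ :=
    enorm_le_iff_norm_le.2 (norm_snd_le (interiorPart Ω s x))
  calc ‖x.2.2‖ₑ ^ s.toReal = energy s.toReal (surf Ω) η := enorm_rpow_eq_energy hs hxb
    _ ≤ C * (energy s.toReal (vol Ω) η + energy s.toReal (vol Ω) (fderiv ℝ η)) :=
      hle η (hη.of_le (by exact_mod_cast le_top))
    _ = C * (‖x.1‖ₑ ^ s.toReal + ‖x.2.1‖ₑ ^ s.toReal) := by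
      rw [enorm_rpow_eq_energy hs hx, enorm_rpow_eq_energy hs hxg, energy_gradient]
    _ ≤ C * (‖interiorPart Ω s x‖ₑ ^ s.toReal + ‖interiorPart Ω s x‖ₑ ^ s.toReal) := by gcongr
    _ = C * 2 * ‖interiorPart Ω s x‖ₑ ^ s.toReal := by ring

theorem IsBoundedLipschitz.exists_norm_le_interiorPart (hΩ : IsBoundedLipschitz Ω) (hs : s ≠ ⊤) :
    ∃ K : ℝ≥0, ∀ x ∈ (smoothTriples Ω s).topologicalClosure, ‖x‖ ≤ K * ‖interiorPart Ω s x‖ := by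
  obtain ⟨K, hK⟩ := hΩ.exists_boundaryPart_le hs
  refine ⟨max 1 K, fun x hx => ?_⟩
  have hfst : ‖x.1‖ ≤ ‖interiorPart Ω s x‖ := norm_fst_le (interiorPart Ω s x)
  have hsnd : ‖x.2.1‖ ≤ ‖interiorPart Ω s x‖ := norm_snd_le (interiorPart Ω s x)
  rw [NNReal.coe_max, NNReal.coe_one, max_mul_of_nonneg _ _ (norm_nonneg _), one_mul]
  exact norm_prod_le_iff.2 ⟨hfst.trans (le_max_left _ _), norm_prod_le_iff.2
    ⟨hsnd.trans (le_max_left _ _), (hK x hx).trans (le_max_right _ _)⟩⟩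

theorem IsBoundedLipschitz.exists_isTrace (hΩ : IsBoundedLipschitz Ω) (hs : s ≠ ⊤)
    (ξ : sobolev Ω s) : ∃ g, IsTrace ξ g := by
  obtain ⟨η, hη, hηf, hηG⟩ := hΩ.isSmoothlyApproximable hs ξ
  choose x hx using fun n =>
    hΩ.exists_isTripleOf (s := s) ((hη n).of_le (by exact_mod_cast le_top))
  have hlim : Tendsto (fun n => interiorPart Ω s (x n)) atTop (𝓝 (fn ξ, grad ξ)) :=
    ((tendsto_Lp_iff_of_coeFn_ae_eq (fun n => (hx n).1) _).2 hηf).prodMk_nhds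
      ((tendsto_Lp_iff_of_coeFn_ae_eq (fun n => (hx n).2.1) _).2 hηG)
  obtain ⟨K, hK⟩ := hΩ.exists_norm_le_interiorPart hs
  obtain ⟨y, hy, hyξ⟩ := (isClosed_image_of_norm_le_mul
    (Submodule.isClosed_topologicalClosure _) _ hK).mem_of_tendsto hlim
    (.of_forall fun n => mem_image_of_mem _ (Submodule.le_topologicalClosure _ ⟨η n, hη n, hx n⟩))
  obtain ⟨hyf, hyG⟩ := Prod.ext_iff.1 hyξ
  have hyeq : y = (fn ξ, grad ξ, y.2.2) := Prod.ext hyf (Prod.ext hyG rfl)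
  exact ⟨y.2.2, hΩ.isTrace_iff.2 (hyeq ▸ hy)⟩

theorem IsBoundedLipschitz.trace_mem (hΩ : IsBoundedLipschitz Ω) (hs : s ≠ ⊤) (ξ : sobolev Ω s) :
    (fn ξ, grad ξ, trace ξ) ∈ (smoothTriples Ω s).topologicalClosure := by
  have h := hΩ.exists_isTrace hs ξ
  rw [← hΩ.isTrace_iff, trace, dif_pos h]
  exact h.choose_spec

theorem IsBoundedLipschitz.trace_eq (hΩ : IsBoundedLipschitz Ω) (hs : s ≠ ⊤) {ξ : sobolev Ω s}
    {g : Lp ℝ s (surf Ω)} (hg : (fn ξ, grad ξ, g) ∈ (smoothTriples Ω s).topologicalClosure) :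
    trace ξ = g := by
  obtain ⟨K, hK⟩ := hΩ.exists_norm_le_interiorPart hs
  have hle := hK _ (Submodule.sub_mem _ (hΩ.trace_mem hs ξ) hg)
  have hzero : interiorPart Ω s ((fn ξ, grad ξ, trace ξ) - (fn ξ, grad ξ, g)) = 0 := by
    rw [map_sub, sub_eq_zero]
    rfl
  rw [hzero, norm_zero, mul_zero, norm_le_zero_iff, sub_eq_zero] at hle
  exact congrArg (fun x => x.2.2) hle

theorem IsBoundedLipschitz.exists_norm_sub_smul_le (hΩ : IsBoundedLipschitz Ω)
    (hconn : IsConnected Ω) (hs : s ≠ ⊤) {e : Triple Ω s} (he : IsTripleOf (fun _ => 1) e) :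
    ∃ K : ℝ≥0, ∀ x ∈ smoothTriples Ω s, ∃ c : ℝ, ‖x - c • e‖ ≤ K * ‖gradientPart Ω s x‖ := by
  have hp : 1 ≤ s.toReal := ENNReal.toReal_mono hs hs1.out
  obtain ⟨K, hK⟩ := hΩ.exists_norm_le_interiorPart hs
  obtain ⟨C, hC, hle⟩ := hΩ.exists_energy_sub_const_le hp hconn
  let L : ℝ≥0 := max (C ^ s.toReal⁻¹).toNNReal 1
  have he_grad : e.2.1 = 0 := Lp.ext (he.2.1.trans ((Lp.coeFn_zero _ _ _).trans
    (.of_eq (funext fun z => (gradient_fun_const z 1).symm))).symm)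
  refine ⟨K * L, ?_⟩
  rintro x ⟨η, hη, hx, hxg, hxb⟩
  obtain ⟨c, hc⟩ := hle η (hη.of_le (by exact_mod_cast le_top))
  have hfst : ‖(x - c • e).1‖ ≤ (C ^ s.toReal⁻¹).toNNReal * ‖x.2.1‖ := by
    refine norm_le_of_enorm_rpow_le (one_pos.trans_le hp) hC ?_
    have hval : (x - c • e).1 =ᵐ[vol Ω] fun z => η z - c := by
      filter_upwards [Lp.coeFn_sub x.1 (c • e.1), Lp.coeFn_smul c e.1, hx, he.1]
        with z h1 h2 h3 h4
      rw [Prod.fst_sub, Prod.smul_fst, h1, Pi.sub_apply, h2, Pi.smul_apply, h3, h4, smul_eq_mul,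
        mul_one]
    rwa [enorm_rpow_eq_energy hs hval, enorm_rpow_eq_energy hs hxg, energy_gradient]
  have hsnd : (x - c • e).2.1 = x.2.1 := by simp [he_grad]
  have hinterior : ‖interiorPart Ω s (x - c • e)‖ ≤ L * ‖x.2.1‖ := by
    rw [NNReal.coe_max, NNReal.coe_one, max_mul_of_nonneg _ _ (norm_nonneg _), one_mul]
    exact max_le_max hfst (congrArg norm hsnd).le
  have hmem : x - c • e ∈ smoothTriples Ω s := Submodule.sub_mem _ ⟨η, hη, hx, hxg, hxb⟩
    (Submodule.smul_mem _ _ ⟨_, contDiff_const, he⟩)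
  refine ⟨c, (hK _ (Submodule.le_topologicalClosure _ hmem)).trans ?_⟩
  rw [NNReal.coe_mul, mul_assoc]
  exact mul_le_mul_of_nonneg_left hinterior K.2

/-- Taking for `N` the mean over `Ω`, or the trace on a part of `∂Ω` of positive measure, gives the
classical Poincaré inequalities. -/
theorem IsBoundedLipschitz.exists_norm_le_gradientPart (hΩ : IsBoundedLipschitz Ω)
    (hconn : IsConnected Ω) (hs : s ≠ ⊤) {Y : Type*} [NormedAddCommGroup Y] [NormedSpace ℝ Y]
    (N : Triple Ω s →L[ℝ] Y) {e : Triple Ω s} (he : IsTripleOf (fun _ => 1) e) (hN : N e ≠ 0) :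
    ∃ K : ℝ≥0, ∀ x ∈ (smoothTriples Ω s).topologicalClosure, N x = 0 →
      ‖x‖ ≤ K * ‖gradientPart Ω s x‖ := by
  obtain ⟨K, hK⟩ := hΩ.exists_norm_sub_smul_le hconn hs he
  obtain ⟨K', hK'⟩ := exists_norm_le_mul_of_sub_smul_le (gradientPart Ω s) N hN K.2 hK
  refine ⟨K', fun x hx hNx => ?_⟩
  have hle : ‖x‖ ≤ K' * ‖(gradientPart Ω s x, N x)‖ :=
    norm_le_mul_norm_of_mem_closure (.id ℝ _) _ hK' x hx
  rwa [hNx, Prod.norm_mk (gradientPart Ω s x), norm_zero, max_eq_left (norm_nonneg _)] at hle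

end Poincare

section FunctionalAnalysis

variable {X Y : Type*} [NormedAddCommGroup X] [NormedSpace ℝ X] [NormedAddCommGroup Y]
  [NormedSpace ℝ Y]

theorem exists_dual_vanishing_of_notMem {M : Submodule ℝ Y} (hM : IsClosed (M : Set Y)) {y : Y}
    (hy : y ∉ M) : ∃ F : Y →L[ℝ] ℝ, (∀ m ∈ M, F m = 0) ∧ F y ≠ 0 := by
  have : IsClosed (M.toAddSubgroup : Set Y) := hM
  obtain ⟨F, hF⟩ := SeparatingDual.exists_ne_zero (R := ℝ)
    (mt (Submodule.Quotient.mk_eq_zero M).1 hy)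
  refine ⟨F ∘L M.mkQL, fun m hm => ?_, hF⟩
  have hmk : M.mkQL m = 0 := (Submodule.Quotient.mk_eq_zero M).2 hm
  rw [ContinuousLinearMap.comp_apply, hmk, map_zero]

theorem exists_dual_comp_eq_of_norm_le_mul {W : Submodule ℝ X} (B : X →L[ℝ] Y) {K : ℝ≥0}
    (hB : ∀ x ∈ W, ‖x‖ ≤ K * ‖B x‖) (ℓ : X →L[ℝ] ℝ) : ∃ F : Y →L[ℝ] ℝ, ∀ x ∈ W, F (B x) = ℓ x := by
  have hanti : AntilipschitzWith K (B ∘L W.subtypeL) :=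
    ContinuousLinearMap.antilipschitz_of_bound _ fun x => hB x x.2
  let e := LinearEquiv.ofInjective (B ∘L W.subtypeL : W →ₗ[ℝ] Y) hanti.injective
  have hbound : ∀ y,
      ‖((ℓ : X →ₗ[ℝ] ℝ) ∘ₗ W.subtype ∘ₗ e.symm.toLinearMap) y‖ ≤ ‖ℓ‖ * K * ‖y‖ := fun y => by
    obtain ⟨x, rfl⟩ := e.surjective y
    calc ‖ℓ (e.symm (e x))‖ = ‖ℓ x‖ := by rw [e.symm_apply_apply]
      _ ≤ ‖ℓ‖ * (K * ‖B x‖) := ℓ.le_opNorm_of_le (hB x x.2)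
      _ = ‖ℓ‖ * K * ‖e x‖ := (mul_assoc _ _ _).symm
  obtain ⟨F, hF, -⟩ := exists_extension_norm_eq (𝕜 := ℝ) _ (LinearMap.mkContinuous _ _ hbound)
  refine ⟨F, fun x hx => (hF (e ⟨x, hx⟩)).trans ?_⟩
  exact congrArg (fun w : W => ℓ w) (e.symm_apply_apply ⟨x, hx⟩)

end FunctionalAnalysis

section SobolevZero

theorem exists_clm_eq_integral {α X Y Z : Type*} [MeasurableSpace α] {μ : Measure α}
    [NormedAddCommGroup X] [NormedSpace ℝ X] [NormedAddCommGroup Y] [NormedSpace ℝ Y]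
    [NormedAddCommGroup Z] [NormedSpace ℝ Z] [CompleteSpace Z] {s r : ℝ≥0∞} [Fact (1 ≤ s)]
    [ENNReal.HolderConjugate s r] (B : Y →L[ℝ] X →L[ℝ] Z) {g : α → Y} (hg : MemLp g r μ) :
    ∃ A : Lp X s μ →L[ℝ] Z, ∀ f, A f = ∫ x, B (g x) (f x) ∂μ := by
  have : ENNReal.HolderConjugate r s := .symm
  have : Fact (1 ≤ r) := ⟨ENNReal.HolderConjugate.one_le r s⟩
  refine ⟨B.lpPairing μ r s (hg.toLp g), fun f => ?_⟩
  rw [ContinuousLinearMap.lpPairing_eq_integral]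
  refine integral_congr_ae ?_
  filter_upwards [hg.coeFn_toLp] with x hx
  rw [hx]

variable {d : ℕ} {Ω : Set (E d)} {s : ℝ≥0∞} [hs1 : Fact (1 ≤ s)]

variable (Ω s) in
theorem isClosed_sobolev : IsClosed (sobolev Ω s : Set (Lp ℝ s (vol Ω) × Lp (E d) s (vol Ω))) := by
  have hconj : ENNReal.HolderConjugate s s.conjExponent := .conjExponent hs1.out
  rw [← isSeqClosed_iff_isClosed]
  intro ξ ζ hξ hlim η hη hηc hηΩ
  have hη1 : ContDiff ℝ 1 η := hη.of_le (by exact_mod_cast le_top)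
  obtain ⟨A, hA⟩ := exists_clm_eq_integral (s := s) (ContinuousLinearMap.lsmul ℝ ℝ (E := E d)).flip
    ((continuous_gradient hη1).memLp_of_hasCompactSupport (p := s.conjExponent) (μ := vol Ω)
      (hasCompactSupport_gradient hηc))
  obtain ⟨B, hB⟩ := exists_clm_eq_integral (s := s) (ContinuousLinearMap.lsmul ℝ ℝ (E := E d))
    (hη.continuous.memLp_of_hasCompactSupport (p := s.conjExponent) (μ := vol Ω) hηc)
  have hAB : ∀ ζ : Lp ℝ s (vol Ω) × Lp (E d) s (vol Ω), (∫ x in Ω, ζ.1 x • gradient η x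
      = - ∫ x in Ω, η x • ζ.2 x) ↔ A ζ.1 = - B ζ.2 := fun ζ => by rw [hA, hB]; rfl
  refine (hAB ζ).2 (tendsto_nhds_unique ((A.continuous.tendsto _).comp hlim.fst_nhds) ?_)
  refine ((B.continuous.tendsto _).comp hlim.snd_nhds).neg.congr fun n => ?_
  exact ((hAB (ξ n)).1 (hξ n η hη hηc hηΩ)).symm

theorem LpToLpRestrictCLM_eq_zero_iff {α X : Type*} [MeasurableSpace α] [NormedAddCommGroup X]
    [NormedSpace ℝ X] {μ : Measure α} {S : Set α} {f : Lp X s μ} :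
    LpToLpRestrictCLM α X ℝ μ s S f = 0 ↔ ∀ᵐ x ∂μ.restrict S, f x = 0 := by
  rw [Lp.eq_zero_iff_ae_eq_zero]
  exact (LpToLpRestrictCLM_coeFn ℝ S f).congr_left

/-- `N` is the mean over `Ω` if `Sp` is negligible and the trace on `Sp` otherwise. -/
theorem IsBoundedLipschitz.exists_normalization (hΩ : IsBoundedLipschitz Ω) (hne : Ω.Nonempty)
    (Sp : Set (E d)) : ∃ N : Triple Ω s →L[ℝ] ℝ × Lp ℝ s ((surf Ω).restrict Sp),
      (∀ e, IsTripleOf (fun _ => 1) e → N e ≠ 0) ∧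
      ∀ ψ, ψ ∈ sobolevZero Ω s Sp ↔ N (fn ψ, grad ψ, trace ψ) = 0 := by
  by_cases h0 : surf Ω Sp = 0
  · have := hΩ.isFiniteMeasure_vol
    have hconj : ENNReal.HolderConjugate s s.conjExponent := .conjExponent hs1.out
    obtain ⟨A, hA⟩ := exists_clm_eq_integral (s := s) (ContinuousLinearMap.lsmul ℝ ℝ (E := ℝ))
      (memLp_const (p := s.conjExponent) (μ := vol Ω) 1)
    have hmean : ∀ f, A f = ∫ x in Ω, f x := fun f => by simp [hA]
    refine ⟨.inl ℝ _ _ ∘L A ∘L .fst ℝ _ _, fun e he h => ?_, fun ψ => ?_⟩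
    · have hvol : (vol Ω).real univ = 0 := calc
        (vol Ω).real univ = ∫ x in Ω, e.1 x := by rw [integral_congr_ae he.1]; simp
        _ = 0 := (hmean e.1).symm.trans (congrArg Prod.fst h)
      rw [measureReal_eq_zero_iff, Measure.restrict_apply_univ] at hvol
      exact (hΩ.isOpen.measure_pos volume hne).ne' hvol
    · simp [sobolevZero, h0, hmean]
  · refine ⟨.inr ℝ _ _ ∘L LpToLpRestrictCLM (E d) ℝ ℝ (surf Ω) s Sp ∘L boundaryPart Ω s,
      fun e he h => h0 ?_, fun ψ => ?_⟩
    · have hzero := LpToLpRestrictCLM_eq_zero_iff.1 (congrArg Prod.snd h)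
      have hfalse : ∀ᵐ _ ∂(surf Ω).restrict Sp, False := by
        filter_upwards [hzero, ae_restrict_of_ae he.2.2] with x h1 h2
        exact one_ne_zero (h2.symm.trans h1)
      rwa [eventually_false_iff_eq_bot, ae_eq_bot, Measure.restrict_eq_zero] at hfalse
    · simp [sobolevZero, h0, pos_iff_ne_zero, boundaryPart, LpToLpRestrictCLM_eq_zero_iff]

/-- `W` is `W_0^{1,s}(Ω)` as a closed subspace of `Triple Ω s`; the bound is its Poincaré
inequality. -/
theorem IsBoundedLipschitz.exists_sobolevZeroTriples (hΩ : IsBoundedLipschitz Ω)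
    (hconn : IsConnected Ω) (hs : s ≠ ⊤) (Sp : Set (E d)) : ∃ W : Submodule ℝ (Triple Ω s),
      IsClosed (W : Set (Triple Ω s)) ∧
      (∀ x, x ∈ W ↔ ∃ ψ ∈ sobolevZero Ω s Sp, x = (fn ψ, grad ψ, trace ψ)) ∧
      ∃ K : ℝ≥0, ∀ x ∈ W, ‖x‖ ≤ K * ‖gradientPart Ω s x‖ := by
  obtain ⟨N, hNe, hN⟩ := hΩ.exists_normalization (s := s) hconn.nonempty Sp
  obtain ⟨e, he⟩ := hΩ.exists_isTripleOf (s := s) (contDiff_const (c := (1 : ℝ)))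
  obtain ⟨K, hK⟩ := hΩ.exists_norm_le_gradientPart hconn hs N he (hNe e he)
  refine ⟨(smoothTriples Ω s).topologicalClosure ⊓
    (sobolev Ω s).comap (interiorPart Ω s : Triple Ω s →ₗ[ℝ] _) ⊓ N.ker, ?_, fun x => ⟨?_, ?_⟩, K,
    fun x hx => hK x hx.1.1 hx.2⟩
  · exact ((Submodule.isClosed_topologicalClosure _).inter
      ((isClosed_sobolev Ω s).preimage (interiorPart Ω s).continuous)).inter N.isClosed_ker
  · rintro ⟨⟨hx, hξ⟩, hNx⟩
    have htr : trace ⟨interiorPart Ω s x, hξ⟩ = x.2.2 := hΩ.trace_eq hs hx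
    have heq : x = (fn ⟨interiorPart Ω s x, hξ⟩, grad ⟨interiorPart Ω s x, hξ⟩,
        trace ⟨interiorPart Ω s x, hξ⟩) := by rw [htr]; rfl
    exact ⟨⟨interiorPart Ω s x, hξ⟩, (hN _).2 (heq ▸ hNx), heq⟩
  · rintro ⟨ψ, hψ, rfl⟩
    exact ⟨⟨hΩ.trace_mem hs ψ, ψ.2⟩, (hN ψ).1 hψ⟩

theorem exists_dataFunctionalL {r : ℝ≥0∞} [ENNReal.HolderConjugate s r]
    (Sv : Set (E d)) (q : Lp ℝ r (vol Ω)) (u₀ : Lp ℝ r ((surf Ω).restrict Sv)) :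
    ∃ ℓ : Triple Ω s →L[ℝ] ℝ, ∀ ψ, ℓ (fn ψ, grad ψ, trace ψ) = dataFunctional Sv q u₀ ψ := by
  obtain ⟨A, hA⟩ := exists_clm_eq_integral (s := s) (ContinuousLinearMap.mul ℝ ℝ) (Lp.memLp q)
  obtain ⟨B, hB⟩ := exists_clm_eq_integral (s := s) (ContinuousLinearMap.mul ℝ ℝ) (Lp.memLp u₀)
  refine ⟨(-A) ∘L .fst ℝ _ _ + B ∘L LpToLpRestrictCLM (E d) ℝ ℝ (surf Ω) s Sv ∘L boundaryPart Ω s,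
    fun ψ => congrArg₂ (fun a b => -a + b) (hA _) ((hB _).trans (integral_congr_ae ?_))⟩
  filter_upwards [LpToLpRestrictCLM_coeFn (p := s) ℝ Sv (trace ψ)] with x hx
  exact congrArg (u₀ x * ·) hx

end SobolevZero

section Riesz

variable {α X : Type*} [MeasurableSpace α] {μ : Measure α}
  [NormedAddCommGroup X] {s r : ℝ≥0∞}

theorem exponent_le_two [ENNReal.HolderConjugate s r] (hr : 2 ≤ r) : s ≤ 2 := by
  rw [← ENNReal.inv_le_inv, ← ENNReal.HolderConjugate.one_sub_inv r s, ← ENNReal.one_sub_inv_two]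
  exact tsub_le_tsub_left (ENNReal.inv_le_inv.2 hr) 1

theorem ofReal_integral_norm_rpow_eq {f : α → X} (hr0 : r ≠ 0) (hr : r ≠ ⊤) (hf : MemLp f r μ) :
    ENNReal.ofReal (∫ x, ‖f x‖ ^ r.toReal ∂μ) = eLpNorm f r μ ^ r.toReal := by
  rw [hf.eLpNorm_eq_integral_rpow_norm hr0 hr,
    ENNReal.ofReal_rpow_of_nonneg (by positivity) ENNReal.toReal_nonneg,
    Real.rpow_inv_rpow (by positivity) (ENNReal.toReal_pos hr0 hr).ne']

section Inclusion

variable [NormedSpace ℝ X]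

theorem exists_inclusionL [IsFiniteMeasure μ] {p q : ℝ≥0∞} [hp : Fact (1 ≤ p)] [Fact (1 ≤ q)]
    (hpq : p ≤ q) : ∃ J : Lp X q μ →L[ℝ] Lp X p μ, ∀ f, J f =ᵐ[μ] f := by
  have hle : q⁻¹ ≤ p⁻¹ := ENNReal.inv_le_inv.2 hpq
  have hone : Fact (1 ≤ (p⁻¹ - q⁻¹)⁻¹) :=
    ⟨ENNReal.one_le_inv.2 (tsub_le_self.trans (ENNReal.inv_le_one.2 hp.out))⟩
  have htriple : ENNReal.HolderTriple (p⁻¹ - q⁻¹)⁻¹ q p :=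
    ⟨by rw [inv_inv, tsub_add_cancel_of_le hle]⟩
  have hmem : MemLp (fun _ => (1 : ℝ)) (p⁻¹ - q⁻¹)⁻¹ μ := memLp_const 1
  refine ⟨(ContinuousLinearMap.lsmul ℝ ℝ (E := X)).holderL μ _ q p (hmem.toLp _), fun f => ?_⟩
  filter_upwards [(ContinuousLinearMap.lsmul ℝ ℝ (E := X)).coeFn_holder (r := p) (hmem.toLp _) f,
    hmem.coeFn_toLp] with x hx h1
  exact hx.trans (by rw [h1]; exact one_smul ℝ _)

theorem eq_of_comp_inclusionL_eq {Y : Type*} [NormedAddCommGroup Y] [NormedSpace ℝ Y]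
    [Fact (1 ≤ s)] (hs : s ≠ ⊤) {p : ℝ≥0∞} {J : Lp X p μ → Lp X s μ} (hJ : ∀ f, J f =ᵐ[μ] f)
    {F G : Lp X s μ →L[ℝ] Y} (h : ∀ f, F (J f) = G (J f)) : F = G := by
  ext1 g
  induction g using Lp.induction hs with
  | indicatorConst c ht hμt =>
    have hind : indicatorConstLp s ht hμt.ne c = J (indicatorConstLp p ht hμt.ne c) :=
      Lp.ext (indicatorConstLp_coeFn.trans ((hJ _).trans indicatorConstLp_coeFn).symm)
    rw [Lp.simpleFunc.coe_indicatorConst, hind, h]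
  | add hf hg _ h1 h2 => rw [map_add, map_add, h1, h2]
  | isClosed => exact isClosed_eq F.continuous G.continuous

end Inclusion

variable [InnerProductSpace ℝ X]

/-- The duality map `v ↦ |v|^(R - 2) v`, which realises equality in Hölder's inequality between
`L^R` and its dual. -/
noncomputable def dualityMap (R : ℝ) (v : X) : X := ‖v‖ ^ (R - 2) • v

theorem norm_dualityMap {R : ℝ} (hR : 1 < R) (v : X) : ‖dualityMap R v‖ = ‖v‖ ^ (R - 1) := by
  rw [dualityMap, norm_smul, Real.norm_of_nonneg (by positivity)]
  rcases (norm_nonneg v).eq_or_lt with h | h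
  · rw [← h, mul_zero, Real.zero_rpow (by linarith)]
  · rw [← Real.rpow_add_one h.ne']
    congr 1
    ring

theorem inner_dualityMap_self {R : ℝ} (hR : 0 < R) (v : X) :
    inner ℝ (dualityMap R v) v = ‖v‖ ^ R := by
  rw [dualityMap, real_inner_smul_left, real_inner_self_eq_norm_sq]
  rcases (norm_nonneg v).eq_or_lt with h | h
  · simp [← h, Real.zero_rpow hR.ne']
  · rw [← Real.rpow_natCast, ← Real.rpow_add h]
    simp

variable [ENNReal.HolderConjugate s r]

theorem eLpNorm_dualityMap (hs : s ≠ ⊤) (hr : r ≠ ⊤) (f : α → X) :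
    eLpNorm (fun x => dualityMap r.toReal (f x)) s μ = eLpNorm f r μ ^ (r.toReal - 1) := by
  have hconj := ENNReal.HolderConjugate.toReal_of_ne_top hs hr
  have hr1 : 0 < r.toReal - 1 := sub_pos.2 hconj.symm.lt
  have hexp : s * ENNReal.ofReal (r.toReal - 1) = r := by
    rw [← ENNReal.ofReal_toReal hs, ← ENNReal.ofReal_mul ENNReal.toReal_nonneg, mul_comm,
      hconj.symm.sub_one_mul_conj, ENNReal.ofReal_toReal hr]
  have hpow := eLpNorm_norm_rpow (p := s) (μ := μ) f hr1
  rw [hexp] at hpow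
  rw [← hpow]
  refine eLpNorm_congr_norm_ae (.of_forall fun x => ?_)
  rw [norm_dualityMap hconj.symm.lt, Real.norm_of_nonneg (by positivity)]

variable [IsFiniteMeasure μ]

theorem memLp_dualityMap_of_bound {p : ℝ≥0∞} {R : ℝ} (hR : 1 < R) {f : α → X}
    (hf : StronglyMeasurable f) {C : ℝ} (hC : ∀ x, ‖f x‖ ≤ C) :
    MemLp (fun x => dualityMap R (f x)) p μ := by
  refine .of_bound ((hf.norm.measurable.pow_const _).stronglyMeasurable.smul
    hf).aestronglyMeasurable (C ^ (R - 1)) (.of_forall fun x => ?_)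
  rw [norm_dualityMap hR]
  exact Real.rpow_le_rpow (norm_nonneg _) (hC x) (by linarith)

variable [Fact (1 ≤ s)]

theorem eLpNorm_indicator_le_enorm_of_dual (hr : 2 ≤ r) (hr_top : r ≠ ⊤)
    {F : Lp X s μ →L[ℝ] ℝ} {J : Lp X 2 μ →L[ℝ] Lp X s μ} (hJ : ∀ f, J f =ᵐ[μ] f)
    {φ : Lp X 2 μ} (hφ : ∀ f, F (J f) = ∫ x, inner ℝ (f x) (φ x) ∂μ)
    {A : Set α} (hA : MeasurableSet A) {C : ℝ} (hC : ∀ x ∈ A, ‖φ x‖ ≤ C) :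
    eLpNorm (A.indicator φ) r μ ≤ ‖F‖ₑ := by
  set R := r.toReal
  set ψ := A.indicator φ
  have hR : 2 ≤ R := by simpa using ENNReal.toReal_mono hr_top hr
  have hψm : StronglyMeasurable ψ := (Lp.stronglyMeasurable φ).indicator hA
  have hψC : ∀ x, ‖ψ x‖ ≤ max C 0 := fun x => by
    by_cases hx : x ∈ A
    · simp [ψ, hx, hC x hx]
    · simp [ψ, hx]
  have hψ : MemLp ψ r μ := .of_bound hψm.aestronglyMeasurable _ (.of_forall hψC)
  -- `F` is tested with the duality map of the truncation `ψ` of `φ`.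
  have hg : MemLp (fun x => dualityMap R (ψ x)) 2 μ :=
    memLp_dualityMap_of_bound (by linarith) hψm hψC
  set g := hg.toLp _
  have hFg : F (J g) = ∫ x, ‖ψ x‖ ^ R ∂μ := by
    rw [hφ]
    refine integral_congr_ae ?_
    filter_upwards [hg.coeFn_toLp] with x hx
    rw [hx, ← inner_dualityMap_self (by linarith)]
    by_cases hxA : x ∈ A
    · simp [ψ, hxA]
    · simp [ψ, hxA, dualityMap]
  have hJg : ‖J g‖ₑ = eLpNorm ψ r μ ^ (R - 1) := by
    rw [Lp.enorm_def, eLpNorm_congr_ae ((hJ g).trans hg.coeFn_toLp)]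
    exact eLpNorm_dualityMap (ne_top_of_le_ne_top ENNReal.ofNat_ne_top (exponent_le_two hr))
      hr_top ψ
  have hmul : eLpNorm ψ r μ * eLpNorm ψ r μ ^ (R - 1) ≤ ‖F‖ₑ * eLpNorm ψ r μ ^ (R - 1) := calc
    eLpNorm ψ r μ * eLpNorm ψ r μ ^ (R - 1) = eLpNorm ψ r μ ^ (1 + (R - 1)) := by
        rw [ENNReal.rpow_add_of_nonneg _ _ zero_le_one (by linarith), ENNReal.rpow_one]
    _ = ENNReal.ofReal (∫ x, ‖ψ x‖ ^ R ∂μ) := by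
        rw [ofReal_integral_norm_rpow_eq (zero_lt_two.trans_le hr).ne' hr_top hψ,
          add_sub_cancel]
    _ = ENNReal.ofReal (F (J g)) := by rw [hFg]
    _ ≤ ‖F (J g)‖ₑ := Real.ofReal_le_enorm _
    _ ≤ ‖F‖ₑ * eLpNorm ψ r μ ^ (R - 1) := hJg ▸ F.le_opENorm _
  rcases eq_or_ne (eLpNorm ψ r μ) 0 with h0 | h0
  · exact h0.trans_le zero_le
  · exact (ENNReal.mul_le_mul_iff_left (ENNReal.rpow_pos (pos_iff_ne_zero.2 h0) hψ.2.ne).ne'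
      (ENNReal.rpow_ne_top_of_nonneg (by linarith) hψ.2.ne)).1 hmul

theorem memLp_of_dual (hr : 2 ≤ r) (hr_top : r ≠ ⊤)
    {F : Lp X s μ →L[ℝ] ℝ} {J : Lp X 2 μ →L[ℝ] Lp X s μ} (hJ : ∀ f, J f =ᵐ[μ] f)
    {φ : Lp X 2 μ} (hφ : ∀ f, F (J f) = ∫ x, inner ℝ (f x) (φ x) ∂μ) : MemLp φ r μ := by
  have hm := Lp.stronglyMeasurable φ
  have hA : ∀ n : ℕ, MeasurableSet {x | ‖φ x‖ ≤ n} := fun n =>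
    measurableSet_le hm.norm.measurable measurable_const
  have hlim : ∀ x, Tendsto (fun n : ℕ => {x | ‖φ x‖ ≤ n}.indicator φ x) atTop (𝓝 (φ x)) :=
    fun x => tendsto_const_nhds.congr' <| by
      filter_upwards [eventually_ge_atTop ⌈‖φ x‖⌉₊] with n hn
      exact (indicator_of_mem (show x ∈ {x | ‖φ x‖ ≤ n} from Nat.ceil_le.1 hn) _).symm
  refine ⟨hm.aestronglyMeasurable, (Lp.eLpNorm_lim_le_liminf_eLpNorm
    (fun n => (hm.indicator (hA n)).aestronglyMeasurable) _ (.of_forall hlim)).trans_lt ?_⟩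
  exact (liminf_le_of_le (by isBoundedDefault) fun b hb => (hb.exists.choose_spec.trans
    (eLpNorm_indicator_le_enorm_of_dual hr hr_top hJ hφ (hA _) fun x hx => hx))).trans_lt
    enorm_lt_top

theorem exists_lpPairing_eq [CompleteSpace X] [Fact (1 ≤ r)] (hr : 2 ≤ r) (hr_top : r ≠ ⊤)
    (F : Lp X s μ →L[ℝ] ℝ) :
    ∃ φ : Lp X r μ, ∀ g, F g = (innerSL ℝ).lpPairing μ s r g φ := by
  have hs : s ≤ 2 := exponent_le_two hr
  obtain ⟨J, hJ⟩ := exists_inclusionL (X := X) (μ := μ) hs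
  obtain ⟨φ₂, hφ₂⟩ : ∃ φ₂ : Lp X 2 μ, ∀ f, F (J f) = ∫ x, inner ℝ (f x) (φ₂ x) ∂μ :=
    ⟨(InnerProductSpace.toDual ℝ _).symm (F ∘L J), fun f => by
      rw [← L2.inner_def, real_inner_comm, InnerProductSpace.toDual_symm_apply]
      rfl⟩
  have hmem := memLp_of_dual hr hr_top hJ hφ₂
  refine ⟨hmem.toLp φ₂, DFunLike.congr_fun (g := ((innerSL ℝ).lpPairing μ s r).flip _)
    (eq_of_comp_inclusionL_eq (ne_top_of_le_ne_top ENNReal.ofNat_ne_top hs) hJ fun f => ?_)⟩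
  rw [hφ₂, ContinuousLinearMap.flip_apply, ContinuousLinearMap.lpPairing_eq_integral]
  refine integral_congr_ae ?_
  filter_upwards [hJ f, hmem.coeFn_toLp] with x h1 h2
  rw [h1, h2]
  rfl

end Riesz

section Duality

variable {d : ℕ} {Ω : Set (E d)} {r s : ℝ≥0∞} [Fact (1 ≤ r)] [Fact (1 ≤ s)]
  [ENNReal.HolderConjugate s r]

theorem ne_top_of_two_le_conjugate {r s : ℝ≥0∞} [ENNReal.HolderConjugate s r] (hr : 2 ≤ r) :
    s ≠ ⊤ :=
  ne_top_of_le_ne_top ENNReal.ofNat_ne_top (exponent_le_two hr)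

theorem IsBoundedLipschitz.exists_pairing_eq (hΩ : IsBoundedLipschitz Ω) (hr : 2 ≤ r)
    (hr_top : r ≠ ⊤) (F : Lp (E d) s (vol Ω) →L[ℝ] ℝ) :
    ∃ φ : Lp (E d) r (vol Ω), ∀ g, F g = pairing g φ := by
  have := hΩ.isFiniteMeasure_vol
  exact exists_lpPairing_eq hr hr_top F

theorem IsBoundedLipschitz.eq_of_forall_pairing_eq (hΩ : IsBoundedLipschitz Ω) (hr : 2 ≤ r)
    (hr_top : r ≠ ⊤) {g g' : Lp (E d) s (vol Ω)}
    (h : ∀ φ : Lp (E d) r (vol Ω), pairing g φ = pairing g' φ) : g = g' := by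
  refine (SeparatingDual.eq_iff_forall_dual_eq (R := ℝ)).2 fun F => ?_
  obtain ⟨φ, hφ⟩ := hΩ.exists_pairing_eq hr hr_top F
  rw [hφ, hφ, h φ]

theorem IsBoundedLipschitz.exists_grad_eq_of_annihilates (hΩ : IsBoundedLipschitz Ω)
    (hconn : IsConnected Ω) {Sp : Set (E d)} (hr : 2 ≤ r) (hr_top : r ≠ ⊤)
    {g : Lp (E d) s (vol Ω)} (hg : ∀ φ ∈ V Ω r s Sp, pairing g φ = 0) :
    ∃ p ∈ sobolevZero Ω s Sp, grad p = g := by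
  obtain ⟨W, hWc, hW, K, hK⟩ :=
    hΩ.exists_sobolevZeroTriples (s := s) hconn (ne_top_of_two_le_conjugate hr) Sp
  have hmap : g ∈ W.map (gradientPart Ω s : Triple Ω s →ₗ[ℝ] _) := by
    by_contra hgW
    obtain ⟨F, hF0, hFg⟩ := exists_dual_vanishing_of_notMem
      (isClosed_image_of_norm_le_mul hWc (gradientPart Ω s) hK) hgW
    obtain ⟨φ, hφ⟩ := hΩ.exists_pairing_eq hr hr_top F
    have hφV : φ ∈ V Ω r s Sp := fun ψ hψ => by
      rw [← hφ]
      exact hF0 _ ⟨_, (hW _).2 ⟨ψ, hψ, rfl⟩, rfl⟩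
    exact hFg ((hφ g).trans (hg φ hφV))
  obtain ⟨x, hx, rfl⟩ := hmap
  obtain ⟨p, hp, rfl⟩ := (hW x).1 hx
  exact ⟨p, hp, rfl⟩

theorem IsBoundedLipschitz.grad_injOn_sobolevZero (hΩ : IsBoundedLipschitz Ω)
    (hconn : IsConnected Ω) (hs : s ≠ ⊤) (Sp : Set (E d)) :
    InjOn (grad (Ω := Ω) (s := s)) (sobolevZero Ω s Sp) := by
  obtain ⟨W, -, hW, K, hK⟩ := hΩ.exists_sobolevZeroTriples hconn hs Sp
  intro p hp p' hp' h
  have hgrad : gradientPart Ω s ((fn p, grad p, trace p) - (fn p', grad p', trace p')) = 0 := by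
    rw [map_sub, sub_eq_zero]
    exact h
  have hle := hK _ (W.sub_mem ((hW _).2 ⟨p, hp, rfl⟩) ((hW _).2 ⟨p', hp', rfl⟩))
  rw [hgrad, norm_zero, mul_zero, norm_le_zero_iff, sub_eq_zero] at hle
  exact Subtype.ext (Prod.ext (congrArg (fun x : Triple Ω s => x.1) hle) h)

theorem IsBoundedLipschitz.exists_isLift (hΩ : IsBoundedLipschitz Ω) (hconn : IsConnected Ω)
    (hr : 2 ≤ r) (hr_top : r ≠ ⊤) (Sv Sp : Set (E d)) (q : Lp ℝ r (vol Ω))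
    (u₀ : Lp ℝ r ((surf Ω).restrict Sv)) : ∃ u, IsLift s Sv Sp q u₀ u := by
  obtain ⟨W, -, hW, K, hK⟩ :=
    hΩ.exists_sobolevZeroTriples hconn (ne_top_of_two_le_conjugate (s := s) hr) Sp
  obtain ⟨ℓ, hℓ⟩ := exists_dataFunctionalL (s := s) Sv q u₀
  obtain ⟨F, hF⟩ := exists_dual_comp_eq_of_norm_le_mul (gradientPart Ω s) hK ℓ
  obtain ⟨u, hu⟩ := hΩ.exists_pairing_eq hr hr_top F
  refine ⟨u, fun ψ hψ => ?_⟩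
  rw [← hu, ← hℓ]
  exact hF _ ((hW _).2 ⟨ψ, hψ, rfl⟩)

variable {Sv Sp : Set (E d)} {q : Lp ℝ r (vol Ω)} {u₀ : Lp ℝ r ((surf Ω).restrict Sv)}
  {f₀ : Lp (E d) s (vol Ω)} {u uhat v : Lp (E d) r (vol Ω)}

theorem IsLift.sub_mem (hu : IsLift s Sv Sp q u₀ u) (huhat : IsLift s Sv Sp q u₀ uhat) :
    u - uhat ∈ V Ω r s Sp := fun ψ hψ => by
  rw [map_sub, hu ψ hψ, huhat ψ hψ, sub_self]

theorem IsLift.add_left (huhat : IsLift s Sv Sp q u₀ uhat) (hv : v ∈ V Ω r s Sp) :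
    IsLift s Sv Sp q u₀ (v + uhat) := fun ψ hψ => by
  rw [map_add, hv ψ hψ, zero_add, huhat ψ hψ]

theorem IsBoundedLipschitz.existsUnique_lift_class (hΩ : IsBoundedLipschitz Ω)
    (hconn : IsConnected Ω) (hr : 2 ≤ r) (hr_top : r ≠ ⊤) (Sv Sp : Set (E d))
    (q : Lp ℝ r (vol Ω)) (u₀ : Lp ℝ r ((surf Ω).restrict Sv)) :
    ∃! U : Lp (E d) r (vol Ω) ⧸ V Ω r s Sp, ∀ uhat : Lp (E d) r (vol Ω),
      (Submodule.Quotient.mk uhat : _ ⧸ V Ω r s Sp) = U → IsLift s Sv Sp q u₀ uhat := by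
  obtain ⟨u, hu⟩ := hΩ.exists_isLift (s := s) hconn hr hr_top Sv Sp q u₀
  refine ⟨Submodule.Quotient.mk u, fun uhat h => ?_, fun U' hU' => ?_⟩
  · simpa only [sub_add_cancel] using hu.add_left ((Submodule.Quotient.eq _).1 h)
  · obtain ⟨u', rfl⟩ := Submodule.Quotient.mk_surjective _ U'
    exact (Submodule.Quotient.eq _).2 ((hU' u' rfl).sub_mem hu)

theorem IsBoundedLipschitz.solvesMixedWith_iff (hΩ : IsBoundedLipschitz Ω) (hr : 2 ≤ r)
    (hr_top : r ≠ ⊤) {Λu : Lp (E d) s (vol Ω)} {p : sobolev Ω s} (hp : p ∈ sobolevZero Ω s Sp) :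
    SolvesMixedWith Sv Sp q u₀ f₀ Λu u p ↔ grad p = f₀ - Λu ∧ IsLift s Sv Sp q u₀ u := by
  constructor
  · intro h
    refine ⟨hΩ.eq_of_forall_pairing_eq hr hr_top fun φ => ?_, fun ψ hψ => (h 0 ψ hψ).2⟩
    rw [map_sub, sub_apply, (h φ p hp).1]
    ring
  · rintro ⟨hgrad, hu⟩ φ ψ hψ
    refine ⟨?_, hu ψ hψ⟩
    rw [hgrad, map_sub, sub_apply]
    ring

theorem IsBoundedLipschitz.existsUnique_pressure (hΩ : IsBoundedLipschitz Ω)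
    (hconn : IsConnected Ω) (hr : 2 ≤ r) (hr_top : r ≠ ⊤)
    (huhat : IsLift s Sv Sp q u₀ uhat) (hv : v ∈ V Ω r s Sp) {Λv : Lp (E d) s (vol Ω)}
    (hΛ : ∀ φ ∈ V Ω r s Sp, pairing Λv φ = pairing f₀ φ) :
    ∃! p : sobolev Ω s, p ∈ sobolevZero Ω s Sp ∧
      SolvesMixedWith Sv Sp q u₀ f₀ Λv (v + uhat) p := by
  obtain ⟨p, hp, hgrad⟩ := hΩ.exists_grad_eq_of_annihilates hconn (g := f₀ - Λv) hr hr_top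
    fun φ hφ => by rw [map_sub, sub_apply, hΛ φ hφ, sub_self]
  refine ⟨p, ⟨hp, (hΩ.solvesMixedWith_iff hr hr_top hp).2 ⟨hgrad, huhat.add_left hv⟩⟩, ?_⟩
  rintro p' ⟨hp', hsol⟩
  exact hΩ.grad_injOn_sobolevZero hconn (ne_top_of_two_le_conjugate hr) Sp hp' hp
    (((hΩ.solvesMixedWith_iff hr hr_top hp').1 hsol).1.trans hgrad.symm)

variable {φ₁ φ₂ : ℝ≥0 → ℝ≥0}

theorem SolvesMixed.solvesReduced {p : sobolev Ω s} (h : SolvesMixed Sv Sp φ₁ φ₂ q u₀ f₀ u p)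
    (huhat : IsLift s Sv Sp q u₀ uhat) : SolvesReduced Sp φ₁ φ₂ f₀ uhat (u - uhat) := by
  obtain ⟨hp, Λu, hΛ, hsol⟩ := h
  have hu : IsLift s Sv Sp q u₀ u := fun ψ hψ => (hsol 0 ψ hψ).2
  refine ⟨hu.sub_mem huhat, Λu, by rwa [sub_add_cancel], fun φ hφ => ?_⟩
  rw [(hsol φ p hp).1, hφ p hp, neg_zero, zero_add]

theorem SolvesReduced.exists_solvesMixed (h : SolvesReduced Sp φ₁ φ₂ f₀ uhat v)
    (hΩ : IsBoundedLipschitz Ω) (hconn : IsConnected Ω) (hr : 2 ≤ r) (hr_top : r ≠ ⊤)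
    (huhat : IsLift s Sv Sp q u₀ uhat) : ∃ p, SolvesMixed Sv Sp φ₁ φ₂ q u₀ f₀ (v + uhat) p := by
  obtain ⟨hv, Λv, hΛv, hΛ⟩ := h
  obtain ⟨p, ⟨hp, hsol⟩, -⟩ := hΩ.existsUnique_pressure hconn hr hr_top huhat hv hΛ
  exact ⟨p, hp, Λv, hΛv, hsol⟩

end Duality

end Fracture

open Fracture in
theorem lemma4p3_general {d : ℕ} {Ω : Set (E d)} (hΩ : IsBoundedLipschitz Ω)
    (hconn : IsConnected Ω) {r s : ℝ≥0∞} [Fact (1 ≤ r)] [Fact (1 ≤ s)]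
    [ENNReal.HolderConjugate s r] (hr : 2 ≤ r) (hr_top : r ≠ ⊤) (Sv Sp : Set (E d))
    (φ₁ φ₂ : ℝ≥0 → ℝ≥0) (q : Lp ℝ r (vol Ω)) (u₀ : Lp ℝ r ((surf Ω).restrict Sv))
    (f₀ : Lp (E d) s (vol Ω)) :
    (∃! U : Lp (E d) r (vol Ω) ⧸ V Ω r s Sp, ∀ uhat : Lp (E d) r (vol Ω),
      (Submodule.Quotient.mk uhat : _ ⧸ V Ω r s Sp) = U → IsLift s Sv Sp q u₀ uhat) ∧
    ∀ uhat : Lp (E d) r (vol Ω), IsLift s Sv Sp q u₀ uhat →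
      (∀ (u : Lp (E d) r (vol Ω)) (p : sobolev Ω s), SolvesMixed Sv Sp φ₁ φ₂ q u₀ f₀ u p →
        SolvesReduced Sp φ₁ φ₂ f₀ uhat (u - uhat)) ∧
      (∀ v : Lp (E d) r (vol Ω), SolvesReduced Sp φ₁ φ₂ f₀ uhat v →
        ∃ p : sobolev Ω s, SolvesMixed Sv Sp φ₁ φ₂ q u₀ f₀ (v + uhat) p) ∧
      (∀ v ∈ V Ω r s Sp, ∀ Λv ∈ law s φ₁ φ₂ (v + uhat),
        (∀ φ ∈ V Ω r s Sp, pairing Λv φ = pairing f₀ φ) →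
          ∃! p : sobolev Ω s, p ∈ sobolevZero Ω s Sp ∧
            SolvesMixedWith Sv Sp q u₀ f₀ Λv (v + uhat) p) :=
  ⟨hΩ.existsUnique_lift_class hconn hr hr_top Sv Sp q u₀, fun _ huhat =>
    ⟨fun _ _ h => h.solvesReduced huhat,
      fun _ h => h.exists_solvesMixed hΩ hconn hr hr_top huhat,
      fun _ hv _ _ hΛ => hΩ.existsUnique_pressure hconn hr hr_top huhat hv hΛ⟩⟩

theorem lemma4p3 {d : ℕ} (hd : 1 ≤ d)
    (Ω Sv Sp : Set (Fracture.E d))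
    (hΩ_open : IsOpen Ω) (hΩ_bdd : Bornology.IsBounded Ω) (hΩ_conn : IsConnected Ω)
    (hΩ_lip : Fracture.HasLipschitzBoundary Ω)
    (hSv : Fracture.IsRelOpenInBoundary Ω Sv) (hSp : Fracture.IsRelOpenInBoundary Ω Sp)
    (hdisj : Disjoint Sv Sp) (hcover : frontier Ω = closure (Sv ∪ Sp))
    {r s : ℝ≥0∞} [Fact (1 ≤ r)] [Fact (1 ≤ s)] [ENNReal.HolderConjugate s r]
    (hr : 2 ≤ r) (hr_top : r ≠ ⊤)
    (φ₁ φ₂ : ℝ≥0 → ℝ≥0) (hφ : Fracture.IsAdmissible r φ₁ φ₂)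
    (q : Lp ℝ r (Fracture.vol Ω)) (u₀ : Lp ℝ r ((Fracture.surf Ω).restrict Sv))
    (f₀ : Lp (Fracture.E d) s (Fracture.vol Ω)) :
    -- existence and uniqueness of the lift in the quotient space
    (∃! U : Lp (Fracture.E d) r (Fracture.vol Ω) ⧸ Fracture.V Ω r s Sp,
      ∀ uhat : Lp (Fracture.E d) r (Fracture.vol Ω),
        (Submodule.Quotient.mk uhat : _ ⧸ Fracture.V Ω r s Sp) = U →
          Fracture.IsLift s Sv Sp q u₀ uhat) ∧
    ∀ uhat : Lp (Fracture.E d) r (Fracture.vol Ω), Fracture.IsLift s Sv Sp q u₀ uhat →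
      -- a solution of the mixed problem gives one of the reduced problem
      (∀ (u : Lp (Fracture.E d) r (Fracture.vol Ω)) (p : Fracture.sobolev Ω s),
        Fracture.SolvesMixed Sv Sp φ₁ φ₂ q u₀ f₀ u p →
          Fracture.SolvesReduced Sp φ₁ φ₂ f₀ uhat (u - uhat)) ∧
      -- a solution of the reduced problem gives one of the mixed problem
      (∀ v : Lp (Fracture.E d) r (Fracture.vol Ω),
        Fracture.SolvesReduced Sp φ₁ φ₂ f₀ uhat v →
          ∃ p : Fracture.sobolev Ω s, Fracture.SolvesMixed Sv Sp φ₁ φ₂ q u₀ f₀ (v + uhat) p) ∧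
      -- for each admissible selection, the pressure is unique
      (∀ v ∈ Fracture.V Ω r s Sp, ∀ Λv ∈ Fracture.law s φ₁ φ₂ (v + uhat),
        (∀ φ ∈ Fracture.V Ω r s Sp, Fracture.pairing Λv φ = Fracture.pairing f₀ φ) →
          ∃! p : Fracture.sobolev Ω s, p ∈ Fracture.sobolevZero Ω s Sp ∧
            Fracture.SolvesMixedWith Sv Sp q u₀ f₀ Λv (v + uhat) p) :=
  lemma4p3_general ⟨hΩ_open, hΩ_bdd, hΩ_lip⟩ hΩ_conn hr hr_top Sv Sp φ₁ φ₂ q u₀ f₀
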